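/- On $\mathbb R^3$ with coordinates $(q,p,s)$ and contact form $\eta=ds-p\,dq$, the contact Hamiltonian vector field of a function $h$ is $$X_h=\frac{\partial h}{\partial p}\,\partial_q-\Big(p\frac{\partial h}{\partial s}+\frac{\partial h}{\partial q}\Big)\partial_p+\Big(p\frac{\partial h}{\partial p}-h\Big)\partial_s .$$ For $\epsilon\in\mathbb R$ let $\mathcal H_\epsilon=A+B+C$ with $A=-\epsilon(1-q^2)s$, $B=q$, $C=ps$ be the van der Pol contact Hamiltonian, and consider the exact flow maps $$e^{\tau X_A}:(q,p,s)\mapsto\big(q,\;e^{\epsilon\tau(1-q^2)}(p-2\epsilon\tau qs),\;e^{\epsilon\tau(1-q^2)}s\big),$$ $$e^{\tau X_B}:(q,p,s)\mapsto(q,\;p-\tau,\;s-\tau q),\qquad e^{\tau X_C}:(q,p,s)\mapsto\Big(q+\tau s,\;\frac{p}{1+p\tau},\;s\Big).$$ A contact splitting integrator is one of the basic splittings $$S_2(\tau)=e^{\frac\tau2X_{1}}e^{\frac\tau2X_{2}}e^{\tau X_{3}}e^{\frac\tau2X_{2}}e^{\frac\tau2X_{1}},$$ where $(X_1,X_2,X_3)$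 is any ordering of $(X_A,X_B,X_C)$, or is obtained from one of these by finitely many symmetric compositions $S(w_m\tau)\cdots S(w_1\tau)S(w_0\tau)S(w_1\tau)\cdots S(w_m\tau)$ with $m\ge 0$ and real $w_j$ (independent of $\epsilon$). It has order $2n$ if, for every $\epsilon>0$, its local error against the exact solutions of the system of $\mathcal H_\epsilon$ is $\mathcal O(\tau^{2n+1})$ as $\tau\to0$. A modified Hamiltonian of $S$ is a formal power series $\mathcal K=\sum_{k\ge0}\tau^k\mathcal K_k$ with $\mathcal K_k\in\mathbb R[q,p,s]$ such that $S(\tau)=\exp(\tau X_{\mathcal K})$ as formal power series in $\tau$ (that is, at each point the coordinates of $S(\tau)$ have the asymptotic expansion $\exp(\tau X_{\mathcal K})$ as $\tau\to0$). **Proposition.** Let $n\ge1$ and let $S$ be a contact splitting integrator of order $2n$. For every $\epsilon\in\mathbb R$ it has exactly one modified Hamiltonian; this has the form $$\mathcal H_{mod,2n}=\mathcal H_\epsilon+\sum_{i\ge n}\tau^{2i}\Delta\mathcal H_{2i},$$ where the $\Delta\mathcal H_{2i}$ are polynomials in $\epsilon,q,p,s$. For every $i\ge1$, the truncation of $\mathcal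 H_{mod,2n}$ at order $2i$ in $\tau$ is a polynomial in $\epsilon$ of degree at most $2i$, and so is its coefficient of $\tau^{2i}$; hence no power of $\epsilon$ greater than $\epsilon^{2i}$ accompanies $\tau^{2i}$. The bound is attained: every basic splitting $S_2$ has, for every $\epsilon\in\mathbb R$, exactly one modified Hamiltonian; its coefficients are polynomials in $\epsilon,q,p,s$, and for every $i\ge1$ its truncation at order $2i$ in $\tau$, and its coefficient of $\tau^{2i}$, have degree exactly $2i$ in $\epsilon$, so that its leading terms scale like $(\epsilon\tau)^{2i}$. -/

import Mathlib

open Filter Topology Asymptotics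

/-- Points of the contact phase space `ℝ³`, in Darboux coordinates `x 0 = q`, `x 1 = p`, `x 2 = s`;
the contact form is `ds - p dq`. -/
abbrev Phase : Type := Fin 3 → ℝ

/-- Polynomial functions of `(q, p, s)`; the variables are `X 0 = q`, `X 1 = p`, `X 2 = s`. -/
abbrev PhasePoly : Type := MvPolynomial (Fin 3) ℝ

/-! ### Contact Hamiltonian vector fields -/

/-- The components `(q̇, ṗ, ṡ) = (∂h/∂p, -p ∂h/∂s - ∂h/∂q, p ∂h/∂p - h)` of the contact Hamiltonian
vector field `X_h`. -/
noncomputable def contactField (h : PhasePoly) : Fin 3 → PhasePoly :=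
  ![MvPolynomial.pderiv 1 h,
    -(MvPolynomial.X 1 * MvPolynomial.pderiv 2 h) - MvPolynomial.pderiv 0 h,
    MvPolynomial.X 1 * MvPolynomial.pderiv 1 h - h]

/-- The vector field `X_h` acting on `g` as a derivation. -/
noncomputable def contactDeriv (h g : PhasePoly) : PhasePoly :=
  ∑ c : Fin 3, contactField h c * MvPolynomial.pderiv c g

/-- The operator `τ X_K` on formal power series in `τ`, where `K = ∑ τ^k K_k` is itself a formal
power series in `τ` and `X_K = ∑ τ^k X_{K_k}`. -/
noncomputable def tauContactDeriv (K F : PowerSeries PhasePoly) : PowerSeries PhasePoly :=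
  PowerSeries.X * PowerSeries.mk fun n =>
    ∑ ij ∈ Finset.HasAntidiagonal.antidiagonal n,
      contactDeriv (PowerSeries.coeff ij.1 K) (PowerSeries.coeff ij.2 F)

/-- The coefficient of `τ^n` in `exp(τ X_K) f = ∑ₘ (τ X_K)^m f / m!`. Since `τ X_K` raises the
order in `τ` by at least one, only the terms with `m ≤ n` contribute. -/
noncomputable def lieSeriesCoeff (K : PowerSeries PhasePoly) (f : PhasePoly) (n : ℕ) : PhasePoly :=
  ∑ m ∈ Finset.range (n + 1),
    ((m.factorial : ℝ)⁻¹) • PowerSeries.coeff n ((tauContactDeriv K)^[m] (PowerSeries.C f))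

/-- `K` is a modified Hamiltonian of the one-step method `S` (step `τ`, point `x`): as a formal
power series in `τ`, the map `S τ` is `exp(τ X_K)`, the time-`τ` flow of `X_K`. That is, at each
point, the coordinates of `S τ` have the asymptotic expansion `exp(τ X_K)` as `τ → 0`. -/
def IsModifiedHamiltonian (S : ℝ → Phase → Phase) (K : PowerSeries PhasePoly) : Prop :=
  ∀ (x : Phase) (c : Fin 3) (N : ℕ),
    (fun τ : ℝ => S τ x c - ∑ n ∈ Finset.range (N + 1),
        MvPolynomial.eval x (lieSeriesCoeff K (MvPolynomial.X c) n) * τ ^ n)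
      =O[𝓝 0] fun τ : ℝ => τ ^ (N + 1)

/-- The one-step method `S` has order (at least) `r` for the contact Hamiltonian system of `h`:
its local error against the exact solutions is `O(τ^(r+1))`. -/
def HasOrder (h : PhasePoly) (S : ℝ → Phase → Phase) (r : ℕ) : Prop :=
  ∀ γ : ℝ → Phase,
    (∀ᶠ t in 𝓝 (0 : ℝ),
      HasDerivAt γ (fun c => MvPolynomial.eval (γ t) (contactField h c)) t) →
    (fun τ : ℝ => S τ (γ 0) - γ τ) =O[𝓝 0] fun τ : ℝ => τ ^ (r + 1)

/-! ### The van der Pol oscillator and its contact splitting integrators -/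

/-- The contact Hamiltonian `p s - ε (1 - q²) s + q` of the van der Pol oscillator. -/
noncomputable def vdpHamiltonian (ε : ℝ) : PhasePoly :=
  MvPolynomial.X 1 * MvPolynomial.X 2
    - MvPolynomial.C ε * (1 - MvPolynomial.X 0 ^ 2) * MvPolynomial.X 2
    + MvPolynomial.X 0

/-- Labels of the three parts `A = -ε (1 - q²) s`, `B = q`, `C = p s` of the Hamiltonian. -/
inductive VdPPart : Type
  | A
  | B
  | C

/-- The exact time-`τ` flow maps of `X_A`, `X_B`, `X_C`. -/
noncomputable def vdpMap (ε : ℝ) : VdPPart → ℝ → Phase → Phase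
  | .A, τ, x =>
      ![x 0,
        Real.exp (ε * τ * (1 - x 0 ^ 2)) * (x 1 - 2 * x 0 * x 2 * τ * ε),
        Real.exp (ε * τ * (1 - x 0 ^ 2)) * x 2]
  | .B, τ, x => ![x 0, x 1 - τ, x 2 - τ * x 0]
  | .C, τ, x => ![x 0 + τ * x 2, x 1 / (1 + x 1 * τ), x 2]

/-- The basic symmetric splitting `e^{τ/2 X₁} e^{τ/2 X₂} e^{τ X₃} e^{τ/2 X₂} e^{τ/2 X₁}`,
where the enumeration `σ` says in which order the three parts are used. -/
noncomputable def basicSplitting (σ : Fin 3 ≃ VdPPart) (ε τ : ℝ) : Phase → Phase :=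
  vdpMap ε (σ 0) (τ / 2) ∘ vdpMap ε (σ 1) (τ / 2) ∘ vdpMap ε (σ 2) τ ∘
    vdpMap ε (σ 1) (τ / 2) ∘ vdpMap ε (σ 0) (τ / 2)

/-- The symmetric composition `S(w_m τ) ⋯ S(w_1 τ) S(w_0 τ) S(w_1 τ) ⋯ S(w_m τ)`. -/
def symmetricComposition (S : ℝ → Phase → Phase) (w : ℕ → ℝ) : ℕ → ℝ → Phase → Phase
  | 0, τ => S (w 0 * τ)
  | m + 1, τ => S (w (m + 1) * τ) ∘ symmetricComposition S w m τ ∘ S (w (m + 1) * τ)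

/-- The contact splitting integrators built from the van der Pol maps (functions of `ε`, the step
`τ` and the point): the basic splittings and everything obtained from them by repeated symmetric
compositions with real coefficients. With `m = 1` the latter give the triple-jump compositions with
exact coefficients, with base a basic splitting those with approximate coefficients. -/
inductive IsContactSplittingIntegrator : (ℝ → ℝ → Phase → Phase) → Prop
  | basic (σ : Fin 3 ≃ VdPPart) : IsContactSplittingIntegrator (basicSplitting σ)
  | comp {S : ℝ → ℝ → Phase → Phase} (hS : IsContactSplittingIntegrator S)
      (w : ℕ → ℝ) (m : ℕ) :
      IsContactSplittingIntegrator fun ε τ => symmetricComposition (S ε) w m τ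

/-! ### Dependence on `ε` -/

/-- Evaluate at a real number `ε` a formal power series in `τ` whose coefficients are polynomials
in `ε` over `ℝ[q, p, s]`. -/
noncomputable def atEps (ε : ℝ) (M : PowerSeries (Polynomial PhasePoly)) : PowerSeries PhasePoly :=
  PowerSeries.map (Polynomial.evalRingHom (MvPolynomial.C ε)) M

/-- The truncation `∑_{k ≤ r} τ^k M_k` at order `r` in `τ`, seen as a polynomial in `ε` with
coefficients in `ℝ[q, p, s][τ]`. -/
noncomputable def truncEps (M : PowerSeries (Polynomial PhasePoly)) (r : ℕ) :
    Polynomial (Polynomial PhasePoly) :=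
  ∑ k ∈ Finset.range (r + 1),
    Polynomial.C (Polynomial.X ^ k) * (PowerSeries.coeff k M).map Polynomial.C

/-! ### Functional calculus for operators that raise the order of a power series -/

section FunctionalCalculus

/-! ### Divisibility by powers of the series variable. -/

section Order

variable {P : Type*} [CommRing P]

/-! Existence and uniqueness are formal and bypass the Baker–Campbell–Hausdorff formula. Pulling
functions back along a product of the flows of A, B, C gives an automorphism Φ of power series in τ,
accompanied by a twisted map Ψ = Ψ(1)·Φ that preserves the Jacobi bracket (`IsContactPair`). The
lowest-order term of such a Φ is infinitesimally contact, hence equal to some X_k; removing it and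
iterating writes Φ as exp(τX_K) (`IsContactPair.exists_contactFlow`). Since k = p X_k(q) - X_k(s), K
is unique (`contactFlow_injective`). The analytic notions reduce to these identities because
composition respects asymptotic expansions that are uniform near the base point
(`isModifiedHamiltonian_wordMap_iff`).

All this is done over any `DarbouxRing`. Over ℝ[q,p,s][ε], with ε a constant of the derivations, a
single K serves all ε and its coefficients are polynomial in ε. The integrators are palindromic
words, so S(-τ) inverts S(τ) and K is even in τ (`coeff_eq_zero_of_odd`). Comparison with an exact
solution shows that order 2n kills the coefficients of τ^k for 0 < k < 2n (`X_pow_dvd_of_hasOrder`).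

For the degree, give A a parameter α and B, C a common parameter β. Replacing τ by eτ shows that the
coefficient of τ^k is homogeneous of degree k+1 in (α, β), so the expansions at (ε, 1) and (1, β)
have reversed coefficients (`eval_coeff_eq`, `coeff_of_eval_inv`). At β = 0 only the flow of A
remains and K is a multiple of A, so for k > 0 the power ε^(k+1) is absent. The coefficient of ε^k
is the part linear in β, which the q-component of the map reveals. With D = τX_A, the linear part of
exp(τX_K)q is (e^D-1)/D applied to the linear part of τ∂_pK, and it must equal g(D)(τs) for an
explicit exponential sum g. Hence ∂_p of the coefficient is the k-th Taylor coefficient of x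
g(x)/(e^x-1) times (1-q²)^k s (`d_coeff_one_coeff`). For a basic splitting this function is
(x/2)coth(x/2) or (x/2)/sinh(x/2). Its even coefficients are nonzero because the Bernoulli numbers
B_{2i} are, ζ(2i) being positive. -/

theorem eq_zero_of_forall_X_pow_dvd {F : PowerSeries P}
    (h : ∀ N : ℕ, (PowerSeries.X : PowerSeries P) ^ N ∣ F) : F = 0 := by
  ext n
  exact PowerSeries.X_pow_dvd_iff.1 (h (n + 1)) n (Nat.lt_succ_self n)

theorem eq_of_forall_X_pow_dvd_sub {F G : PowerSeries P}
    (h : ∀ N : ℕ, (PowerSeries.X : PowerSeries P) ^ N ∣ F - G) : F = G :=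
  sub_eq_zero.1 (eq_zero_of_forall_X_pow_dvd h)

theorem X_pow_mul_left_cancel {F G : PowerSeries P} (n : ℕ)
    (h : PowerSeries.X ^ n * F = PowerSeries.X ^ n * G) : F = G := by
  ext k
  have := congrArg (PowerSeries.coeff (k + n)) h
  simpa [PowerSeries.coeff_X_pow_mul] using this

theorem X_dvd_of_X_pow_mul {F : PowerSeries P} (n : ℕ)
    (h : (PowerSeries.X : PowerSeries P) ^ (n + 1) ∣ PowerSeries.X ^ n * F) :
    PowerSeries.X ∣ F := by
  obtain ⟨G, hG⟩ := h
  refine ⟨G, X_pow_mul_left_cancel n ?_⟩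
  rw [hG]; ring

/-- A family of terms of order at least `i + j`, summed over a square or over a triangle. -/
theorem X_pow_dvd_square_sub_triangle {u : ℕ → ℕ → PowerSeries P}
    (hu : ∀ i j, (PowerSeries.X : PowerSeries P) ^ (i + j) ∣ u i j) (N : ℕ) :
    (PowerSeries.X : PowerSeries P) ^ N ∣
      ∑ i ∈ Finset.range N, ∑ j ∈ Finset.range N, u i j -
        ∑ m ∈ Finset.range N, ∑ ij ∈ Finset.HasAntidiagonal.antidiagonal m, u ij.1 ij.2 := by
  have h1 : ∑ m ∈ Finset.range N, ∑ ij ∈ Finset.HasAntidiagonal.antidiagonal m, u ij.1 ij.2 =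
      ∑ i ∈ Finset.range N, ∑ j ∈ Finset.range (N - i), u i j := by
    rw [← Finset.sum_range_diag_flip]
    exact Finset.sum_congr rfl fun m _ =>
      Finset.Nat.sum_antidiagonal_eq_sum_range_succ (fun i j => u i j) m
  rw [h1, ← Finset.sum_sub_distrib]
  refine Finset.dvd_sum fun i _ => ?_
  rw [← Finset.sum_sdiff (Finset.range_mono (Nat.sub_le N i)), add_sub_cancel_right]
  refine Finset.dvd_sum fun j hj => ?_
  simp only [Finset.mem_sdiff, Finset.mem_range] at hj
  exact (pow_dvd_pow _ (by omega)).trans (hu i j)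

end Order

variable {P Q : Type*} [CommRing P] [Algebra ℝ P] [CommRing Q] [Algebra ℝ Q]

theorem dvd_real_smul {a F : PowerSeries P} (h : a ∣ F) (r : ℝ) : a ∣ r • F := by
  obtain ⟨G, rfl⟩ := h
  exact ⟨r • G, by rw [mul_smul_comm]⟩

/-- The operator raises the order in the power series variable by at least one. -/
def RaisesOrder (D : PowerSeries P →ₗ[ℝ] PowerSeries P) : Prop :=
  ∀ (n : ℕ) (F : PowerSeries P),
    (PowerSeries.X : PowerSeries P) ^ n ∣ F → (PowerSeries.X : PowerSeries P) ^ (n + 1) ∣ D F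

theorem RaisesOrder.pow_dvd {D : PowerSeries P →ₗ[ℝ] PowerSeries P} (hD : RaisesOrder D)
    {n : ℕ} {F : PowerSeries P} (hF : (PowerSeries.X : PowerSeries P) ^ n ∣ F) (m : ℕ) :
    (PowerSeries.X : PowerSeries P) ^ (n + m) ∣ (D ^ m) F := by
  induction m with
  | zero => simpa using hF
  | succ m ih =>
    rw [pow_succ', Module.End.mul_apply]
    exact hD _ _ ih

theorem RaisesOrder.pow_dvd' {D : PowerSeries P →ₗ[ℝ] PowerSeries P} (hD : RaisesOrder D)
    (F : PowerSeries P) (m : ℕ) :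
    (PowerSeries.X : PowerSeries P) ^ m ∣ (D ^ m) F := by
  simpa using hD.pow_dvd (n := 0) (by simp) m

/-- The operator `∑ₘ gₘ Dᵐ` for a real power series `g` and an operator `D` that raises the
order. -/
noncomputable def funCalc (g : PowerSeries ℝ) (D : PowerSeries P →ₗ[ℝ] PowerSeries P) :
    PowerSeries P →ₗ[ℝ] PowerSeries P where
  toFun F := PowerSeries.mk fun n => ∑ m ∈ Finset.range (n + 1),
    PowerSeries.coeff m g • PowerSeries.coeff n ((D ^ m) F)
  map_add' F G := by
    ext n
    simp [smul_add, Finset.sum_add_distrib]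
  map_smul' r F := by
    ext n
    have h : ∀ G : PowerSeries P, PowerSeries.coeff n (r • G) = r • PowerSeries.coeff n G :=
      fun _ => rfl
    simp only [PowerSeries.coeff_mk, map_smul, h, Finset.smul_sum, RingHom.id_apply]
    exact Finset.sum_congr rfl fun _ _ => smul_comm _ _ _

theorem coeff_real_smul (n : ℕ) (r : ℝ) (F : PowerSeries P) :
    PowerSeries.coeff n (r • F) = r • PowerSeries.coeff n F := rfl

theorem coeff_funCalc (g : PowerSeries ℝ) (D : PowerSeries P →ₗ[ℝ] PowerSeries P)
    (F : PowerSeries P) (n : ℕ) :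
    PowerSeries.coeff n (funCalc g D F) = ∑ m ∈ Finset.range (n + 1),
      PowerSeries.coeff m g • PowerSeries.coeff n ((D ^ m) F) := by
  simp [funCalc]

/-- The term with D^m has order at least m, so modulo X^N the sum is finite. Identities for
`funCalc` thus reduce to identities of finite sums, one N at a time. -/
theorem X_pow_dvd_funCalc_sub {D : PowerSeries P →ₗ[ℝ] PowerSeries P} (hD : RaisesOrder D)
    (g : PowerSeries ℝ) (F : PowerSeries P) {N M : ℕ} (hNM : N ≤ M) :
    (PowerSeries.X : PowerSeries P) ^ N ∣
      funCalc g D F - ∑ m ∈ Finset.range M, PowerSeries.coeff m g • (D ^ m) F := by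
  rw [PowerSeries.X_pow_dvd_iff]
  intro n hn
  rw [map_sub, coeff_funCalc, map_sum, sub_eq_zero]
  simp only [coeff_real_smul]
  refine Finset.sum_subset (Finset.range_mono (by omega)) fun m _ hm => ?_
  rw [Finset.mem_range, not_lt] at hm
  rw [PowerSeries.X_pow_dvd_iff.1 (hD.pow_dvd' F m) n (by omega), smul_zero]

theorem X_pow_dvd_funCalc {D : PowerSeries P →ₗ[ℝ] PowerSeries P} (hD : RaisesOrder D)
    (g : PowerSeries ℝ) {F : PowerSeries P} {N : ℕ}
    (hF : (PowerSeries.X : PowerSeries P) ^ N ∣ F) :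
    (PowerSeries.X : PowerSeries P) ^ N ∣ funCalc g D F := by
  have h := X_pow_dvd_funCalc_sub hD g F (le_refl N)
  refine (dvd_sub_left (Finset.dvd_sum fun m _ => dvd_real_smul ?_ _)).1 h
  exact (pow_dvd_pow _ (Nat.le_add_right N m)).trans (hD.pow_dvd hF m)

/-- Composing truncations gives a sum over a square of indices, while the product series gives a
triangle; the difference has order at least N. Functions of one D can therefore be inverted by
inverting real power series. -/
theorem funCalc_mul {D : PowerSeries P →ₗ[ℝ] PowerSeries P} (hD : RaisesOrder D)
    (g h : PowerSeries ℝ) (F : PowerSeries P) :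
    funCalc (g * h) D F = funCalc g D (funCalc h D F) := by
  refine eq_of_forall_X_pow_dvd_sub fun N => ?_
  have h1 := X_pow_dvd_funCalc_sub hD (g * h) F (le_refl N)
  have h2 := X_pow_dvd_funCalc_sub hD h F (le_refl N)
  have h3 := X_pow_dvd_funCalc hD g h2
  have h4 := X_pow_dvd_funCalc_sub hD g
    (∑ m ∈ Finset.range N, PowerSeries.coeff m h • (D ^ m) F) (le_refl N)
  have h5 := X_pow_dvd_square_sub_triangle
    (u := fun i j => (PowerSeries.coeff i g * PowerSeries.coeff j h) • (D ^ (i + j)) F)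
    (fun i j => dvd_real_smul (hD.pow_dvd' F _) _) N
  have e1 : ∑ m ∈ Finset.range N, PowerSeries.coeff m (g * h) • (D ^ m) F =
      ∑ m ∈ Finset.range N, ∑ ij ∈ Finset.HasAntidiagonal.antidiagonal m,
        (PowerSeries.coeff ij.1 g * PowerSeries.coeff ij.2 h) • (D ^ (ij.1 + ij.2)) F := by
    refine Finset.sum_congr rfl fun m _ => ?_
    rw [PowerSeries.coeff_mul, Finset.sum_smul]
    refine Finset.sum_congr rfl fun ij hij => ?_
    rw [Finset.HasAntidiagonal.mem_antidiagonal.1 hij]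
  have e2 : ∑ m ∈ Finset.range N, PowerSeries.coeff m g •
      (D ^ m) (∑ m ∈ Finset.range N, PowerSeries.coeff m h • (D ^ m) F) =
      ∑ i ∈ Finset.range N, ∑ j ∈ Finset.range N,
        (PowerSeries.coeff i g * PowerSeries.coeff j h) • (D ^ (i + j)) F := by
    refine Finset.sum_congr rfl fun i _ => ?_
    rw [map_sum, Finset.smul_sum]
    refine Finset.sum_congr rfl fun j _ => ?_
    rw [map_smul, smul_smul, pow_add, Module.End.mul_apply]
  rw [e1] at h1
  rw [e2] at h4
  rw [map_sub] at h3
  have := dvd_sub (dvd_sub h1 (dvd_add h3 h4)) h5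
  convert this using 1
  abel

theorem funCalc_one (D : PowerSeries P →ₗ[ℝ] PowerSeries P) (F : PowerSeries P) :
    funCalc 1 D F = F := by
  ext n
  rw [coeff_funCalc, Finset.sum_eq_single 0]
  · simp
  · intro m _ hm
    simp [PowerSeries.coeff_one, hm]
  · simp

theorem funCalc_smul (g : PowerSeries ℝ) (D : PowerSeries P →ₗ[ℝ] PowerSeries P)
    (r : ℝ) (F : PowerSeries P) :
    funCalc g (r • D) F = funCalc (PowerSeries.rescale r g) D F := by
  ext n
  simp only [coeff_funCalc, smul_pow, LinearMap.smul_apply, coeff_real_smul, smul_smul,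
    PowerSeries.coeff_rescale]
  exact Finset.sum_congr rfl fun _ _ => by rw [mul_comm]

/-- Because θ acts separately on each coefficient, it passes through the sum defining g(D). It
covers base change, rescaling of τ and multiplication by constants. -/
theorem funCalc_intertwine {D : PowerSeries P →ₗ[ℝ] PowerSeries P}
    {D' : PowerSeries Q →ₗ[ℝ] PowerSeries Q} (g : PowerSeries ℝ)
    {θ : PowerSeries P → PowerSeries Q} (w : ℕ → P → Q)
    (hw : ∀ n a b, w n (a + b) = w n a + w n b) (hw' : ∀ n (r : ℝ) a, w n (r • a) = r • w n a)
    (hθ : ∀ n F, PowerSeries.coeff n (θ F) = w n (PowerSeries.coeff n F))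
    (h : ∀ F, θ (D F) = D' (θ F)) (F : PowerSeries P) :
    θ (funCalc g D F) = funCalc g D' (θ F) := by
  have hpow : ∀ m, (D' ^ m) (θ F) = θ ((D ^ m) F) := by
    intro m
    induction m with
    | zero => simp
    | succ m ih => rw [pow_succ', Module.End.mul_apply, ih, ← h, pow_succ', Module.End.mul_apply]
  ext n
  let W : P →ₗ[ℝ] Q := ⟨⟨w n, hw n⟩, hw' n⟩
  have hW : ∀ a, w n a = W a := fun _ => rfl
  rw [hθ, coeff_funCalc, coeff_funCalc, hW, map_sum]
  refine Finset.sum_congr rfl fun m _ => ?_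
  rw [hpow, hθ, map_smul, hW]

/-- The exponential of an operator that raises the order. -/
noncomputable def opExp (D : PowerSeries P →ₗ[ℝ] PowerSeries P) :
    PowerSeries P →ₗ[ℝ] PowerSeries P :=
  funCalc (PowerSeries.exp ℝ) D

theorem coeff_exp_real (n : ℕ) :
    PowerSeries.coeff n (PowerSeries.exp ℝ) = ((n.factorial : ℝ))⁻¹ := by
  simp [PowerSeries.coeff_exp]

theorem opExp_neg_opExp {D : PowerSeries P →ₗ[ℝ] PowerSeries P} (hD : RaisesOrder D)
    (F : PowerSeries P) : opExp (-D) (opExp D F) = F := by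
  rw [← neg_one_smul ℝ D, opExp, funCalc_smul, opExp, ← funCalc_mul hD, mul_comm]
  have : PowerSeries.rescale (-1 : ℝ) (PowerSeries.exp ℝ) =
    PowerSeries.evalNegHom (PowerSeries.exp ℝ) := rfl
  rw [this, PowerSeries.exp_mul_exp_neg_eq_one, funCalc_one]

theorem RaisesOrder.neg {D : PowerSeries P →ₗ[ℝ] PowerSeries P} (hD : RaisesOrder D) :
    RaisesOrder (-D) := fun n F hF => by
  rw [LinearMap.neg_apply]
  exact (dvd_neg).2 (hD n F hF)

theorem opExp_opExp_neg {D : PowerSeries P →ₗ[ℝ] PowerSeries P} (hD : RaisesOrder D)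
    (F : PowerSeries P) : opExp D (opExp (-D) F) = F := by
  simpa using opExp_neg_opExp hD.neg F

theorem opExp_zero (F : PowerSeries P) :
    opExp (0 : PowerSeries P →ₗ[ℝ] PowerSeries P) F = F := by
  ext n
  rw [opExp, coeff_funCalc, Finset.sum_eq_single 0]
  · simp
  · intro m _ hm
    simp [zero_pow hm]
  · simp

theorem opExp_of_apply_eq_zero {D : PowerSeries P →ₗ[ℝ] PowerSeries P} {F : PowerSeries P}
    (h : D F = 0) : opExp D F = F := by
  ext n
  rw [opExp, coeff_funCalc, Finset.sum_eq_single 0]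
  · simp
  · intro m _ hm
    obtain ⟨m, rfl⟩ := Nat.exists_eq_succ_of_ne_zero hm
    simp [pow_succ, h]
  · simp

theorem X_dvd_opExp_sub {D : PowerSeries P →ₗ[ℝ] PowerSeries P} (hD : RaisesOrder D)
    (F : PowerSeries P) : (PowerSeries.X : PowerSeries P) ∣ opExp D F - F := by
  simpa [opExp] using X_pow_dvd_funCalc_sub hD (PowerSeries.exp ℝ) F (le_refl 1)

theorem pow_apply_bilinear {D₁ D₂ D₃ : PowerSeries P →ₗ[ℝ] PowerSeries P}
    (B : PowerSeries P →ₗ[ℝ] PowerSeries P →ₗ[ℝ] PowerSeries P)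
    (h : ∀ F G, D₃ (B F G) = B (D₁ F) G + B F (D₂ G)) (m : ℕ) (F G : PowerSeries P) :
    (D₃ ^ m) (B F G) = ∑ ij ∈ Finset.HasAntidiagonal.antidiagonal m,
      m.choose ij.1 • B ((D₁ ^ ij.1) F) ((D₂ ^ ij.2) G) := by
  induction m with
  | zero => simp
  | succ m ih =>
    rw [Finset.sum_antidiagonal_choose_succ_nsmul
      (M := PowerSeries P) (fun i j => B ((D₁ ^ i) F) ((D₂ ^ j) G)) m,
      pow_succ', Module.End.mul_apply, ih, map_sum, ← Finset.sum_add_distrib]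
    refine Finset.sum_congr rfl fun ij hij => ?_
    rw [map_nsmul, h, pow_succ' D₁, pow_succ' D₂, Module.End.mul_apply, Module.End.mul_apply,
      smul_add, add_comm, Nat.choose_symm_of_eq_add (Finset.HasAntidiagonal.mem_antidiagonal.1 hij).symm]

/-- The exponential of a derivation is multiplicative, in a form with three operators. This covers
at once the product, the twisted product and the bracket. -/
theorem opExp_bilinear {D₁ D₂ D₃ : PowerSeries P →ₗ[ℝ] PowerSeries P}
    (h₁ : RaisesOrder D₁) (h₂ : RaisesOrder D₂) (h₃ : RaisesOrder D₃)
    (B : PowerSeries P →ₗ[ℝ] PowerSeries P →ₗ[ℝ] PowerSeries P)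
    (hB : ∀ i j F G, (PowerSeries.X : PowerSeries P) ^ i ∣ F →
      (PowerSeries.X : PowerSeries P) ^ j ∣ G → (PowerSeries.X : PowerSeries P) ^ (i + j) ∣ B F G)
    (h : ∀ F G, D₃ (B F G) = B (D₁ F) G + B F (D₂ G)) (F G : PowerSeries P) :
    opExp D₃ (B F G) = B (opExp D₁ F) (opExp D₂ G) := by
  refine eq_of_forall_X_pow_dvd_sub fun N => ?_
  have t1 := X_pow_dvd_funCalc_sub h₁ (PowerSeries.exp ℝ) F (le_refl N)
  have t2 := X_pow_dvd_funCalc_sub h₂ (PowerSeries.exp ℝ) G (le_refl N)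
  have t3 := X_pow_dvd_funCalc_sub h₃ (PowerSeries.exp ℝ) (B F G) (le_refl N)
  rw [← opExp] at t1 t2 t3
  set SF := ∑ m ∈ Finset.range N, PowerSeries.coeff m (PowerSeries.exp ℝ) • (D₁ ^ m) F with hSF
  set SG := ∑ m ∈ Finset.range N, PowerSeries.coeff m (PowerSeries.exp ℝ) • (D₂ ^ m) G with hSG
  clear_value SF SG
  have b1 := hB N 0 _ (opExp D₂ G) t1 (by simp)
  have b2 := hB 0 N SF _ (by simp) t2
  rw [add_zero, map_sub, LinearMap.sub_apply] at b1
  rw [zero_add, map_sub] at b2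
  have b3 := X_pow_dvd_square_sub_triangle
    (u := fun i j => B (PowerSeries.coeff i (PowerSeries.exp ℝ) • (D₁ ^ i) F)
      (PowerSeries.coeff j (PowerSeries.exp ℝ) • (D₂ ^ j) G))
    (fun i j => hB i j _ _ (dvd_real_smul (h₁.pow_dvd' F i) _)
      (dvd_real_smul (h₂.pow_dvd' G j) _)) N
  have e1 : B SF SG = ∑ i ∈ Finset.range N, ∑ j ∈ Finset.range N,
      B (PowerSeries.coeff i (PowerSeries.exp ℝ) • (D₁ ^ i) F)
      (PowerSeries.coeff j (PowerSeries.exp ℝ) • (D₂ ^ j) G) := by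
    rw [hSF, map_sum, LinearMap.sum_apply]
    exact Finset.sum_congr rfl fun i _ => by rw [hSG, map_sum]
  have e2 : ∑ m ∈ Finset.range N, PowerSeries.coeff m (PowerSeries.exp ℝ) • (D₃ ^ m) (B F G) =
      ∑ m ∈ Finset.range N, ∑ ij ∈ Finset.HasAntidiagonal.antidiagonal m,
      B (PowerSeries.coeff ij.1 (PowerSeries.exp ℝ) • (D₁ ^ ij.1) F)
      (PowerSeries.coeff ij.2 (PowerSeries.exp ℝ) • (D₂ ^ ij.2) G) := by
    refine Finset.sum_congr rfl fun m _ => ?_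
    rw [pow_apply_bilinear B h, Finset.smul_sum]
    refine Finset.sum_congr rfl fun ij hij => ?_
    rw [← Nat.cast_smul_eq_nsmul ℝ, smul_smul, map_smul, map_smul, LinearMap.smul_apply,
      smul_smul]
    congr 1
    -- The numerical content is binom(i+j, i)/(i+j)! = 1/(i! j!).
    rw [← Finset.HasAntidiagonal.mem_antidiagonal.1 hij, coeff_exp_real, coeff_exp_real, coeff_exp_real,
      Nat.choose_symm_add, Nat.add_choose, Nat.cast_div (Nat.factorial_mul_factorial_dvd_factorial_add _ _)
        (by positivity)]
    push_cast
    have := Nat.factorial_ne_zero (ij.1 + ij.2)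
    field_simp
  rw [e1] at b2
  rw [e2] at t3
  have := dvd_sub (dvd_sub t3 (dvd_add b1 b2)) b3
  convert this using 1
  abel

end FunctionalCalculus

/-! ### Rings with Darboux coordinates -/

/-- A commutative real algebra with three commuting derivations `d 0, d 1, d 2` (for `q, p, s`) and
coordinates `x 0, x 1, x 2` dual to them. -/
class DarbouxRing (P : Type*) [CommRing P] [Algebra ℝ P] where
  d : Fin 3 → P →ₗ[ℝ] P
  d_mul : ∀ c f g, d c (f * g) = d c f * g + f * d c g
  d_comm : ∀ c c' f, d c (d c' f) = d c' (d c f)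
  x : Fin 3 → P
  d_x : ∀ c c', d c (x c') = if c = c' then 1 else 0

open DarbouxRing (d x)

namespace DarbouxRing

variable {P Q : Type*} [CommRing P] [Algebra ℝ P] [DarbouxRing P]
  [CommRing Q] [Algebra ℝ Q] [DarbouxRing Q]

theorem d_one (c : Fin 3) : d c (1 : P) = 0 := by
  have h := d_mul c (1 : P) 1
  rw [mul_one, one_mul, mul_one] at h
  simpa using h

theorem d_pow_of_eq_zero {c : Fin 3} {f : P} (hf : d c f = 0) (n : ℕ) : d c (f ^ n) = 0 := by
  induction n with
  | zero => rw [pow_zero, d_one]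
  | succ n ih => rw [pow_succ, d_mul, ih, hf, zero_mul, mul_zero, add_zero]

/-- The contact Hamiltonian vector field of `h` acting on `g`. -/
noncomputable def cderiv (h g : P) : P :=
  d 1 h * d 0 g - (x 1 * d 2 h + d 0 h) * d 1 g + (x 1 * d 1 h - h) * d 2 g

/-- The Jacobi bracket `{f, g} = X_f g + (∂f/∂s) g`. -/
noncomputable def bracket (f g : P) : P := cderiv f g + d 2 f * g

theorem cderiv_add_left (h k g : P) : cderiv (h + k) g = cderiv h g + cderiv k g := by
  simp only [cderiv, map_add]; ring

theorem cderiv_neg_left (h g : P) : cderiv (-h) g = -cderiv h g := by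
  simp only [cderiv, map_neg]; ring

theorem cderiv_add_right (h f g : P) : cderiv h (f + g) = cderiv h f + cderiv h g := by
  simp only [cderiv, map_add]; ring

theorem cderiv_smul_left (r : ℝ) (h g : P) : cderiv (r • h) g = r • cderiv h g := by
  simp only [cderiv, map_smul]; simp only [Algebra.smul_def]; ring

theorem cderiv_smul_right (r : ℝ) (h g : P) : cderiv h (r • g) = r • cderiv h g := by
  simp only [cderiv, map_smul]; simp only [Algebra.smul_def]; ring

theorem cderiv_mul_right (h f g : P) : cderiv h (f * g) = cderiv h f * g + f * cderiv h g := by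
  simp only [cderiv, d_mul]; ring

theorem cderiv_mul_left_of_const {a : P} (ha : ∀ c, d c a = 0) (h g : P) :
    cderiv (a * h) g = a * cderiv h g := by
  simp only [cderiv, d_mul, ha]; ring

theorem cderiv_const_right {a : P} (ha : ∀ c, d c a = 0) (h : P) : cderiv h a = 0 := by
  simp only [cderiv, ha]; ring

theorem cderiv_mul_right_of_const {a : P} (ha : ∀ c, d c a = 0) (h g : P) :
    cderiv h (a * g) = a * cderiv h g := by
  rw [cderiv_mul_right, cderiv_const_right ha, zero_mul, zero_add]

theorem cderiv_x0 (h : P) : cderiv h (x 0) = d 1 h := by simp [cderiv, d_x]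

theorem cderiv_x2 (h : P) : cderiv h (x 2) = x 1 * d 1 h - h := by simp [cderiv, d_x]

/-- Contraction of the contact form with X_h is -h, so the vector field determines its Hamiltonian.
Every uniqueness argument rests on this. -/
theorem eq_of_cderiv (h : P) : h = x 1 * cderiv h (x 0) - cderiv h (x 2) := by
  rw [cderiv_x0, cderiv_x2]; ring

theorem bracket_add_left (h k g : P) : bracket (h + k) g = bracket h g + bracket k g := by
  simp only [bracket, cderiv_add_left, map_add]; ring

theorem bracket_add_right (h f g : P) : bracket h (f + g) = bracket h f + bracket h g := by
  simp only [bracket, cderiv_add_right]; ring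

theorem bracket_smul_left (r : ℝ) (h g : P) : bracket (r • h) g = r • bracket h g := by
  simp only [bracket, cderiv_smul_left, map_smul]; simp only [Algebra.smul_def]; ring

theorem bracket_smul_right (r : ℝ) (h g : P) : bracket h (r • g) = r • bracket h g := by
  simp only [bracket, cderiv_smul_right]; simp only [Algebra.smul_def]; ring

theorem bracket_mul_left_of_const {a : P} (ha : ∀ c, d c a = 0) (h g : P) :
    bracket (a * h) g = a * bracket h g := by
  simp only [bracket, cderiv_mul_left_of_const ha, d_mul, ha]; ring

theorem bracket_mul_right_of_const {a : P} (ha : ∀ c, d c a = 0) (h g : P) :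
    bracket h (a * g) = a * bracket h g := by
  simp only [bracket, cderiv_mul_right_of_const ha]; ring

theorem bracket_mul_right (h f g : P) : bracket h (f * g) = bracket h f * g + f * cderiv h g := by
  simp only [bracket, cderiv_mul_right]; ring

theorem bracket_jacobi (h f g : P) :
    bracket h (bracket f g) = bracket (bracket h f) g + bracket f (bracket h g) := by
  have c1 : ∀ f : P, d 1 (d 0 f) = d 0 (d 1 f) := fun f => d_comm _ _ f
  have c2 : ∀ f : P, d 2 (d 0 f) = d 0 (d 2 f) := fun f => d_comm _ _ f
  have c3 : ∀ f : P, d 2 (d 1 f) = d 1 (d 2 f) := fun f => d_comm _ _ f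
  have e00 : d 0 (x 0 : P) = 1 := by simp [d_x]
  have e01 : d 0 (x 1 : P) = 0 := by simp [d_x]
  have e11 : d 1 (x 1 : P) = 1 := by simp [d_x]
  have e21 : d 2 (x 1 : P) = 0 := by simp [d_x]
  simp only [bracket, cderiv, map_add, map_sub, d_mul, c1, c2, c3, e01, e11, e21]
  ring

/-- The Leibniz rule with {f, f} = 0. It serves to compute the bracket of Ψ(1) with Ψ(1)Φ(g). -/
theorem bracket_self_mul (f g : P) : bracket f (f * g) = f * cderiv f g := by
  simp only [bracket, cderiv, d_mul]; ring

/-- The infinitesimal contact condition, tested on `1` and the coordinates. -/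
theorem cderiv_eq_of_bracket (a0 a1 a2 l : P)
    (h1 : bracket 1 (a0 + l * x 0) + bracket l (x 0) = 0)
    (h2 : bracket (x 1) (a0 + l * x 0) + bracket (a1 + l * x 1) (x 0) = l)
    (h3 : bracket (x 1) (a2 + l * x 2) + bracket (a1 + l * x 1) (x 2) = 0)
    (h4 : bracket (x 0) (a2 + l * x 2) + bracket (a0 + l * x 0) (x 2) = -(a0 + l * x 0))
    (h5 : bracket 1 (a1 + l * x 1) + bracket l (x 1) = 0)
    (h6 : bracket 1 (a2 + l * x 2) + bracket l (x 2) = -l) :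
    cderiv (x 1 * a0 - a2) (x 0) = a0 ∧ cderiv (x 1 * a0 - a2) (x 1) = a1 ∧
      cderiv (x 1 * a0 - a2) (x 2) = a2 := by
  have e : ∀ c c', d c (x c' : P) = if c = c' then 1 else 0 := d_x
  simp only [bracket, cderiv, map_add, d_mul, e, d_one] at h1 h2 h3 h4 h5 h6
  simp only [cderiv, map_sub, d_mul, e]
  simp at h1 h2 h3 h4 h5 h6 ⊢
  -- For the vector field Y with components a0, a1, a2, `k1` is the dp-component of L_Y η = -l η and
  -- `k3` its ds-component.
  have k1 : x 1 * d 1 a0 = d 1 a2 := by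
    linear_combination h4 + x 2 * h1 - x 0 * h6
  have k2 : d 2 a1 + x 1 * d 2 l + d 0 l = 0 := by linear_combination -h5
  have k3 : l = x 1 * d 2 a0 - d 2 a2 := by
    linear_combination x 1 * h1 - h6
  refine ⟨?_, ?_, ?_⟩
  · linear_combination k1
  · linear_combination h3 - x 2 * k2 - x 1 * h2 + x 1 * x 0 * k2 + x 1 * k3
  · linear_combination x 1 * k1

/-! ### Power series over a Darboux ring, formal flows and contact pairs. -/

noncomputable instance : DarbouxRing (PowerSeries P) where
  d c :=
    { toFun := fun F => PowerSeries.mk fun n => d c (PowerSeries.coeff n F)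
      map_add' := fun F G => by ext n; simp
      map_smul' := fun r F => by
        ext n
        simp only [PowerSeries.coeff_mk, coeff_real_smul, map_smul, RingHom.id_apply] }
  d_mul c F G := by
    ext n
    simp [PowerSeries.coeff_mul, d_mul, Finset.sum_add_distrib]
  d_comm c c' F := by
    ext n
    simp [d_comm c c']
  x c := PowerSeries.C (x c)
  d_x c c' := by
    ext n
    rcases n with _ | n
    · by_cases h : c = c' <;> simp [d_x, h]
    · by_cases h : c = c' <;> simp [h, PowerSeries.coeff_C, PowerSeries.coeff_one]

theorem coeff_d (c : Fin 3) (F : PowerSeries P) (n : ℕ) :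
    PowerSeries.coeff n (d c F) = d c (PowerSeries.coeff n F) :=
  PowerSeries.coeff_mk n fun n => d c (PowerSeries.coeff n F)

theorem x_powerSeries (c : Fin 3) : (x c : PowerSeries P) = PowerSeries.C (x c) := rfl

theorem d_X (c : Fin 3) : d c (PowerSeries.X : PowerSeries P) = 0 := by
  ext n
  rw [coeff_d, PowerSeries.coeff_X]
  split_ifs <;> simp [d_one]

theorem d_X_pow (n : ℕ) (c : Fin 3) : d c (PowerSeries.X ^ n : PowerSeries P) = 0 :=
  d_pow_of_eq_zero (d_X c) n

theorem d_C (c : Fin 3) (a : P) : d c (PowerSeries.C a) = PowerSeries.C (d c a) := by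
  ext n
  rw [coeff_d, PowerSeries.coeff_C, PowerSeries.coeff_C]
  split_ifs <;> simp

theorem cderiv_C (h g : P) :
    cderiv (PowerSeries.C h) (PowerSeries.C g) = PowerSeries.C (cderiv h g) := by
  simp only [cderiv, d_C, x_powerSeries, map_add, map_sub, map_mul]

theorem constantCoeff_d (c : Fin 3) (F : PowerSeries P) :
    PowerSeries.constantCoeff (d c F) = d c (PowerSeries.constantCoeff F) := by
  simpa using coeff_d c F 0

theorem constantCoeff_cderiv (F G : PowerSeries P) :
    PowerSeries.constantCoeff (cderiv F G) =
      cderiv (PowerSeries.constantCoeff F) (PowerSeries.constantCoeff G) := by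
  simp only [cderiv, map_add, map_sub, map_mul, constantCoeff_d, x_powerSeries,
    PowerSeries.constantCoeff_C]

theorem constantCoeff_bracket (F G : PowerSeries P) :
    PowerSeries.constantCoeff (bracket F G) =
      bracket (PowerSeries.constantCoeff F) (PowerSeries.constantCoeff G) := by
  simp only [bracket, map_add, map_mul, constantCoeff_d, constantCoeff_cderiv]

theorem X_pow_dvd_cderiv_right (K : PowerSeries P) {F : PowerSeries P} {n : ℕ}
    (hF : (PowerSeries.X : PowerSeries P) ^ n ∣ F) :
    (PowerSeries.X : PowerSeries P) ^ n ∣ cderiv K F := by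
  obtain ⟨G, rfl⟩ := hF
  rw [cderiv_mul_right_of_const (d_X_pow n)]
  exact dvd_mul_right _ _

theorem X_pow_dvd_bracket {F G : PowerSeries P} {m n : ℕ}
    (hF : (PowerSeries.X : PowerSeries P) ^ m ∣ F) (hG : (PowerSeries.X : PowerSeries P) ^ n ∣ G) :
    (PowerSeries.X : PowerSeries P) ^ (m + n) ∣ bracket F G := by
  obtain ⟨F, rfl⟩ := hF
  obtain ⟨G, rfl⟩ := hG
  rw [bracket_mul_left_of_const (d_X_pow m), bracket_mul_right_of_const (d_X_pow n), pow_add,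
    ← mul_assoc]
  exact dvd_mul_right _ _

/-- The operator `τ X_K` on power series in `τ`. -/
noncomputable def contactOp (K : PowerSeries P) : PowerSeries P →ₗ[ℝ] PowerSeries P where
  toFun F := PowerSeries.X * cderiv K F
  map_add' F G := by rw [cderiv_add_right, mul_add]
  map_smul' r F := by rw [cderiv_smul_right, mul_smul_comm, RingHom.id_apply]

/-- The operator `τ {K, ·}` on power series in `τ`. -/
noncomputable def bracketOp (K : PowerSeries P) : PowerSeries P →ₗ[ℝ] PowerSeries P where
  toFun F := PowerSeries.X * bracket K F
  map_add' F G := by rw [bracket_add_right, mul_add]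
  map_smul' r F := by rw [bracket_smul_right, mul_smul_comm, RingHom.id_apply]

theorem contactOp_apply (K F : PowerSeries P) : contactOp K F = PowerSeries.X * cderiv K F := rfl

theorem bracketOp_apply (K F : PowerSeries P) : bracketOp K F = PowerSeries.X * bracket K F := rfl

theorem raisesOrder_contactOp (K : PowerSeries P) : RaisesOrder (contactOp K) := by
  intro n F hF
  rw [contactOp_apply, pow_succ']
  exact mul_dvd_mul_left _ (X_pow_dvd_cderiv_right K hF)

theorem raisesOrder_bracketOp (K : PowerSeries P) : RaisesOrder (bracketOp K) := by
  intro n F hF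
  rw [bracketOp_apply, pow_succ']
  exact mul_dvd_mul_left _ (by simpa using X_pow_dvd_bracket (m := 0) (F := K) (by simp) hF)

theorem contactOp_neg (K : PowerSeries P) : contactOp (-K) = -contactOp K := by
  ext1 F
  rw [LinearMap.neg_apply, contactOp_apply, contactOp_apply, cderiv_neg_left, mul_neg]

/-- The formal time-`τ` flow `exp(τ X_K)`. -/
noncomputable def contactFlow (K : PowerSeries P) : PowerSeries P →ₗ[ℝ] PowerSeries P :=
  opExp (contactOp K)

theorem contactFlow_neg_contactFlow (K F : PowerSeries P) :
    contactFlow (-K) (contactFlow K F) = F := by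
  rw [contactFlow, contactOp_neg, contactFlow, opExp_neg_opExp (raisesOrder_contactOp K)]

theorem contactFlow_contactFlow_neg (K F : PowerSeries P) :
    contactFlow K (contactFlow (-K) F) = F := by
  rw [contactFlow, contactFlow, contactOp_neg, opExp_opExp_neg (raisesOrder_contactOp K)]

/-- `Φ` is a formal contact transformation near the identity and `Ψ` is `Φ` multiplied by the
conformal factor. -/
structure IsContactPair (Φ Ψ : PowerSeries P →ₗ[ℝ] PowerSeries P) : Prop where
  map_one : Φ 1 = 1
  map_X : Φ PowerSeries.X = PowerSeries.X
  map_mul : ∀ F G, Φ (F * G) = Φ F * Φ G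
  map_mul' : ∀ F G, Ψ (F * G) = Ψ F * Φ G
  map_bracket : ∀ F G, Ψ (bracket F G) = bracket (Ψ F) (Ψ G)
  dvd_sub : ∀ F, PowerSeries.X ∣ Φ F - F
  dvd_sub' : ∀ F, PowerSeries.X ∣ Ψ F - F

theorem IsContactPair.id : IsContactPair (P := P) LinearMap.id LinearMap.id where
  map_one := rfl
  map_X := rfl
  map_mul _ _ := rfl
  map_mul' _ _ := rfl
  map_bracket _ _ := rfl
  dvd_sub F := by simp
  dvd_sub' F := by simp

theorem IsContactPair.comp {Φ Ψ Φ' Ψ' : PowerSeries P →ₗ[ℝ] PowerSeries P}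
    (h : IsContactPair Φ Ψ) (h' : IsContactPair Φ' Ψ') :
    IsContactPair (Φ ∘ₗ Φ') (Ψ ∘ₗ Ψ') where
  map_one := by simp [h.map_one, h'.map_one]
  map_X := by simp [h.map_X, h'.map_X]
  map_mul F G := by simp [h.map_mul, h'.map_mul]
  map_mul' F G := by simp [h.map_mul', h'.map_mul']
  map_bracket F G := by simp [h.map_bracket, h'.map_bracket]
  dvd_sub F := by
    simpa using dvd_add (h.dvd_sub (Φ' F)) (h'.dvd_sub F)
  dvd_sub' F := by
    simpa using dvd_add (h.dvd_sub' (Ψ' F)) (h'.dvd_sub' F)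

/-- X_K is a derivation of the product, {K, ·} is a derivation along X_K of the product and, by the
Jacobi identity, a derivation of the bracket. Exponentiating gives the three multiplicative laws. -/
theorem isContactPair_contactFlow (K : PowerSeries P) :
    IsContactPair (contactFlow K) (opExp (bracketOp K)) where
  map_one := opExp_of_apply_eq_zero (by rw [contactOp_apply, cderiv_const_right d_one, mul_zero])
  map_X := opExp_of_apply_eq_zero (by rw [contactOp_apply, cderiv_const_right d_X, mul_zero])
  map_mul F G := opExp_bilinear (raisesOrder_contactOp K) (raisesOrder_contactOp K)
    (raisesOrder_contactOp K) (LinearMap.mul ℝ (PowerSeries P))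
    (fun i j F G hF hG => by
      rw [pow_add]
      exact mul_dvd_mul hF hG)
    (fun F G => by
      simp only [LinearMap.mul_apply', contactOp_apply, cderiv_mul_right]; ring) F G
  map_mul' F G := opExp_bilinear (raisesOrder_bracketOp K) (raisesOrder_contactOp K)
    (raisesOrder_bracketOp K) (LinearMap.mul ℝ (PowerSeries P))
    (fun i j F G hF hG => by
      rw [pow_add]
      exact mul_dvd_mul hF hG)
    (fun F G => by
      simp only [LinearMap.mul_apply', contactOp_apply, bracketOp_apply, bracket_mul_right]
      ring) F G
  map_bracket F G := opExp_bilinear (raisesOrder_bracketOp K) (raisesOrder_bracketOp K)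
    (raisesOrder_bracketOp K)
    (LinearMap.mk₂ ℝ bracket bracket_add_left bracket_smul_left bracket_add_right
      bracket_smul_right)
    (fun i j F G hF hG => X_pow_dvd_bracket hF hG)
    (fun F G => by
      simp only [LinearMap.mk₂_apply, bracketOp_apply, bracket_mul_left_of_const d_X,
        bracket_mul_right_of_const d_X, bracket_jacobi K F G, mul_add]) F G
  dvd_sub := X_dvd_opExp_sub (raisesOrder_contactOp K)
  dvd_sub' := X_dvd_opExp_sub (raisesOrder_bracketOp K)

theorem IsContactPair.map_X_pow_mul {Φ Ψ : PowerSeries P →ₗ[ℝ] PowerSeries P}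
    (h : IsContactPair Φ Ψ) (n : ℕ) (F : PowerSeries P) :
    Φ (PowerSeries.X ^ n * F) = PowerSeries.X ^ n * Φ F := by
  induction n with
  | zero => simp
  | succ n ih => rw [pow_succ', mul_assoc, h.map_mul, h.map_X, ih, mul_assoc]

theorem IsContactPair.X_pow_dvd {Φ Ψ : PowerSeries P →ₗ[ℝ] PowerSeries P}
    (h : IsContactPair Φ Ψ) {n : ℕ} {F : PowerSeries P}
    (hF : (PowerSeries.X : PowerSeries P) ^ n ∣ F) :
    (PowerSeries.X : PowerSeries P) ^ n ∣ Φ F := by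
  obtain ⟨G, rfl⟩ := hF
  rw [h.map_X_pow_mul]
  exact dvd_mul_right _ _

end DarbouxRing

/-! ### Existence and uniqueness of the formal Hamiltonian. -/

namespace DarbouxRing

theorem rescale_C' {R : Type*} [CommRing R] (r a : R) : PowerSeries.rescale r (PowerSeries.C a) = PowerSeries.C a := by
  ext n
  rw [PowerSeries.coeff_rescale, PowerSeries.coeff_C]
  split_ifs with h <;> simp [h]

variable {P Q : Type*} [CommRing P] [Algebra ℝ P] [DarbouxRing P]
  [CommRing Q] [Algebra ℝ Q] [DarbouxRing Q]

theorem bracket_one (g : P) : bracket 1 g = -d 2 g := by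
  simp [bracket, cderiv, d_one]

/-- Perturbation of the bracket of two series at order `n`. -/
theorem bracket_add_X_pow_mul (n : ℕ) (f g u v : PowerSeries P) :
    bracket (f + PowerSeries.X ^ n * u) (g + PowerSeries.X ^ n * v) =
      bracket f g + PowerSeries.X ^ n *
        (bracket f v + bracket u g + PowerSeries.X ^ n * bracket u v) := by
  simp only [bracket_add_left, bracket_add_right, bracket_mul_left_of_const (d_X_pow n),
    bracket_mul_right_of_const (d_X_pow n)]
  ring

/-- The conformal factor of a contact pair agrees with `1` to the order to which the coordinates
are preserved. -/
theorem IsContactPair.conformalFactor {Φ Ψ : PowerSeries P →ₗ[ℝ] PowerSeries P}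
    (h : IsContactPair Φ Ψ) {n : ℕ} {a : Fin 3 → PowerSeries P}
    (ha : ∀ c, Φ (x c) = x c + PowerSeries.X ^ n * a c) :
    ∃ l : PowerSeries P, Ψ 1 = 1 + PowerSeries.X ^ n * l := by
  have hΨ : ∀ F, Ψ F = Ψ 1 * Φ F := fun F => by rw [← h.map_mul', one_mul]
  have hu : IsUnit (Ψ 1) := by
    rw [PowerSeries.isUnit_iff_constantCoeff]
    have := h.dvd_sub' 1
    rw [PowerSeries.X_dvd_iff, map_sub, sub_eq_zero] at this
    rw [this]
    simp
  -- Apply Ψ to {1, x c} and cancel the unit Ψ(1). The right side is 0 for q and -1 for s, and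
  -- `eq_of_cderiv` then recovers Ψ(1) from its action on q and s.
  have key : ∀ c, cderiv (Ψ 1) (Φ (x c)) = Φ (bracket 1 (x c)) := fun c => by
    have h1 := h.map_bracket 1 (x c)
    rw [hΨ (x c), bracket_self_mul, hΨ (bracket _ _)] at h1
    exact (hu.mul_left_cancel h1).symm
  have k0 := key 0
  have k2 := key 2
  rw [bracket_one, d_x, ha, cderiv_add_right, cderiv_mul_right_of_const (d_X_pow n)] at k0 k2
  simp only [Fin.reduceEq, if_false, if_true, neg_zero, map_zero, map_neg, h.map_one] at k0 k2
  refine ⟨cderiv (Ψ 1) (a 2) - x 1 * cderiv (Ψ 1) (a 0), ?_⟩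
  have e := eq_of_cderiv (Ψ 1)
  linear_combination e + x 1 * k0 - k2

/-- The leading term of a contact pair is a contact Hamiltonian vector field. -/
theorem IsContactPair.exists_leading {Φ Ψ : PowerSeries P →ₗ[ℝ] PowerSeries P}
    (h : IsContactPair Φ Ψ) {n : ℕ} (hn : n ≠ 0)
    (hΦ : ∀ c, (PowerSeries.X : PowerSeries P) ^ n ∣ Φ (x c) - x c) :
    ∃ k : P, ∀ c, (PowerSeries.X : PowerSeries P) ^ (n + 1) ∣
      Φ (x c) - x c - PowerSeries.X ^ n * cderiv (PowerSeries.C k) (x c) := by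
  choose a ha using hΦ
  replace ha : ∀ c, Φ (x c) = x c + PowerSeries.X ^ n * a c := fun c => by
    rw [← ha c]; ring
  obtain ⟨l, hl⟩ := h.conformalFactor ha
  have hΨ : ∀ F, Ψ F = Ψ 1 * Φ F := fun F => by rw [← h.map_mul', one_mul]
  set ψ : Fin 3 → PowerSeries P := fun c => a c + l * x c + PowerSeries.X ^ n * (l * a c) with hψ
  have hx : ∀ c, Ψ (x c) = x c + PowerSeries.X ^ n * ψ c := fun c => by
    rw [hΨ, hl, ha, hψ]; ring
  -- Linearization of Ψ{f,g} = {Ψf,Ψg} at order n. The quadratic term has order 2n and drops out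
  -- because n ≠ 0.
  have h0 : ∀ (f g v u w : PowerSeries P), Ψ f = f + PowerSeries.X ^ n * u →
      Ψ g = g + PowerSeries.X ^ n * v → Ψ (bracket f g) = bracket f g + PowerSeries.X ^ n * w →
      bracket (PowerSeries.constantCoeff f) (PowerSeries.constantCoeff v) +
        bracket (PowerSeries.constantCoeff u) (PowerSeries.constantCoeff g) =
        PowerSeries.constantCoeff w := by
    intro f g v u w hf hg hw
    rw [h.map_bracket, hf, hg, bracket_add_X_pow_mul] at hw
    have := congrArg PowerSeries.constantCoeff (X_pow_mul_left_cancel n (add_left_cancel hw))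
    simpa [constantCoeff_bracket, zero_pow hn] using this
  have cψ : ∀ c, PowerSeries.constantCoeff (ψ c) =
      PowerSeries.constantCoeff (a c) + PowerSeries.constantCoeff l * x c := fun c => by
    simp [hψ, zero_pow hn, x_powerSeries]
  have cx : ∀ c, PowerSeries.constantCoeff (x c : PowerSeries P) = x c := fun c => by
    simp [x_powerSeries]
  have hd : ∀ c c', d c (x c' : PowerSeries P) = if c = c' then 1 else 0 := d_x
  have b1 : bracket (1 : PowerSeries P) (x 0) = 0 := by simp [bracket_one, hd]
  have b2 : bracket (x 1 : PowerSeries P) (x 0) = 1 := by simp [bracket, cderiv, hd]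
  have b3 : bracket (x 1 : PowerSeries P) (x 2) = 0 := by simp [bracket, cderiv, hd]
  have b4 : bracket (x 0 : PowerSeries P) (x 2) = -x 0 := by simp [bracket, cderiv, hd]
  have b5 : bracket (1 : PowerSeries P) (x 1) = 0 := by simp [bracket_one, hd]
  have b6 : bracket (1 : PowerSeries P) (x 2) = -1 := by simp [bracket_one, hd]
  have r1 := h0 1 (x 0) _ _ 0 hl (hx 0) (by rw [b1]; simp)
  have r2 := h0 (x 1) (x 0) _ _ l (hx 1) (hx 0) (by rw [b2, hl])
  have r3 := h0 (x 1) (x 2) _ _ 0 (hx 1) (hx 2) (by rw [b3]; simp)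
  have r4 := h0 (x 0) (x 2) _ _ (-ψ 0) (hx 0) (hx 2) (by rw [b4, map_neg, hx]; ring)
  have r5 := h0 1 (x 1) _ _ 0 hl (hx 1) (by rw [b5]; simp)
  have r6 := h0 1 (x 2) _ _ (-l) hl (hx 2) (by rw [b6, map_neg, hl]; ring)
  simp only [cψ, cx, map_neg, map_zero, PowerSeries.constantCoeff_one] at r1 r2 r3 r4 r5 r6
  obtain ⟨e0, e1, e2⟩ := cderiv_eq_of_bracket _ _ _ _ r1 r2 r3 r4 r5 r6
  -- The only possible choice, by `eq_of_cderiv`.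
  refine ⟨x 1 * PowerSeries.constantCoeff (a 0) - PowerSeries.constantCoeff (a 2), fun c => ?_⟩
  rw [ha, add_sub_cancel_left, ← mul_sub, pow_succ, x_powerSeries, cderiv_C]
  refine mul_dvd_mul_left _ ?_
  rw [PowerSeries.X_dvd_iff, map_sub, PowerSeries.constantCoeff_C, sub_eq_zero]
  fin_cases c
  exacts [e0.symm, e1.symm, e2.symm]

/-- First variation of the flow under a perturbation of the Hamiltonian at order `n`. -/
theorem contactFlow_add (K k F : PowerSeries P) (n : ℕ) :
    (PowerSeries.X : PowerSeries P) ^ (n + 2) ∣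
      contactFlow (K + PowerSeries.X ^ n * k) F - contactFlow K F -
        PowerSeries.X ^ (n + 1) * cderiv k F := by
  set K' := K + PowerSeries.X ^ n * k with hK'
  have hD : ∀ F, contactOp K' F = contactOp K F + PowerSeries.X ^ (n + 1) * cderiv k F := by
    intro F
    rw [contactOp_apply, contactOp_apply, hK', cderiv_add_left,
      cderiv_mul_left_of_const (d_X_pow n)]
    ring
  -- Powers with m ≥ 2 differ only from order n+2 on, so in the exponential only m = 1 contributes
  -- to the first variation.
  have hpow : ∀ m, (PowerSeries.X : PowerSeries P) ^ (n + m) ∣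
      (contactOp K' ^ m) F - (contactOp K ^ m) F := by
    intro m
    induction m with
    | zero => simp
    | succ m ih =>
      rw [pow_succ', pow_succ', Module.End.mul_apply, Module.End.mul_apply]
      have h1 := raisesOrder_contactOp K' _ _ ih
      rw [map_sub, hD ((contactOp K ^ m) F)] at h1
      have h2 : (PowerSeries.X : PowerSeries P) ^ (n + m + 1) ∣
          PowerSeries.X ^ (n + 1) * cderiv k ((contactOp K ^ m) F) := by
        rw [show n + m + 1 = n + 1 + m by ring, pow_add]
        exact mul_dvd_mul_left _
          (X_pow_dvd_cderiv_right _ ((raisesOrder_contactOp K).pow_dvd' F m))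
      rw [← add_assoc]
      convert dvd_add h1 h2 using 1
      ring
  have t1 := X_pow_dvd_funCalc_sub (raisesOrder_contactOp K') (PowerSeries.exp ℝ) F
    (le_refl (n + 2))
  have t2 := X_pow_dvd_funCalc_sub (raisesOrder_contactOp K) (PowerSeries.exp ℝ) F
    (le_refl (n + 2))
  have t3 : (PowerSeries.X : PowerSeries P) ^ (n + 2) ∣
      ∑ m ∈ Finset.range (n + 2), PowerSeries.coeff m (PowerSeries.exp ℝ) • (contactOp K' ^ m) F -
      ∑ m ∈ Finset.range (n + 2), PowerSeries.coeff m (PowerSeries.exp ℝ) • (contactOp K ^ m) F -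
      PowerSeries.X ^ (n + 1) * cderiv k F := by
    rw [← Finset.sum_sub_distrib, Finset.sum_range_succ', Finset.sum_range_succ']
    have e : PowerSeries.coeff (0 + 1) (PowerSeries.exp ℝ) • (contactOp K' ^ (0 + 1)) F -
        PowerSeries.coeff (0 + 1) (PowerSeries.exp ℝ) • (contactOp K ^ (0 + 1)) F =
        PowerSeries.X ^ (n + 1) * cderiv k F := by
      rw [zero_add, coeff_exp_real, pow_one, pow_one, hD]
      simp
    rw [e]
    simp only [pow_zero, sub_self, add_zero, add_sub_cancel_right, ← smul_sub]
    refine Finset.dvd_sum fun m _ => dvd_real_smul ?_ _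
    exact (pow_dvd_pow _ (by omega)).trans (hpow (m + 1 + 1))
  have := dvd_add (dvd_sub t1 t2) t3
  convert this using 1
  simp only [contactFlow, opExp]
  abel

theorem X_pow_dvd_contactFlow_sub {K K' : PowerSeries P} {n : ℕ}
    (h : (PowerSeries.X : PowerSeries P) ^ n ∣ K' - K) (F : PowerSeries P) :
    (PowerSeries.X : PowerSeries P) ^ (n + 1) ∣ contactFlow K' F - contactFlow K F := by
  obtain ⟨k, hk⟩ := h
  obtain rfl : K' = K + PowerSeries.X ^ n * k := by rw [← hk]; ring
  have h1 := (pow_dvd_pow _ (Nat.le_succ (n + 1))).trans (contactFlow_add K k F n)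
  exact (dvd_sub_left (dvd_mul_right _ _)).1 h1

/-- The flow to order `n + 1` determines the Hamiltonian to order `n`. -/
theorem X_pow_dvd_sub_of_contactFlow {K K' : PowerSeries P} {n : ℕ}
    (h : ∀ c, (PowerSeries.X : PowerSeries P) ^ (n + 1) ∣
      contactFlow K' (x c) - contactFlow K (x c)) :
    (PowerSeries.X : PowerSeries P) ^ n ∣ K' - K := by
  induction n with
  | zero => simp
  | succ n ih =>
    -- If the Hamiltonians differ by τ^n k, the flows differ by τ^(n+1) X_k to leading order. So X_k
    -- vanishes on coordinates modulo τ, and with it k.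
    obtain ⟨k, hk⟩ := ih fun c => (pow_dvd_pow _ (Nat.le_succ _)).trans (h c)
    obtain rfl : K' = K + PowerSeries.X ^ n * k := by rw [← hk]; ring
    have hc : ∀ c, PowerSeries.X ∣ cderiv k (x c) := fun c => by
      have h1 := _root_.dvd_sub (h c) (contactFlow_add K k (x c) n)
      rw [sub_sub_cancel] at h1
      exact X_dvd_of_X_pow_mul _ h1
    rw [add_sub_cancel_left, pow_succ]
    refine mul_dvd_mul_left _ ?_
    rw [eq_of_cderiv k]
    exact _root_.dvd_sub ((hc 0).mul_left _) (hc 2)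

theorem contactFlow_injective {K K' : PowerSeries P}
    (h : ∀ c, contactFlow K' (x c) = contactFlow K (x c)) : K' = K :=
  eq_of_forall_X_pow_dvd_sub fun N => X_pow_dvd_sub_of_contactFlow fun c => by rw [h c]; simp

/-- One Newton-like correction: composing Φ with the inverse of the current flow leaves a contact
pair that starts at order n+1. Its leading term X_k is absorbed by adding τ^n k to K. -/
theorem IsContactPair.exists_step {Φ Ψ : PowerSeries P →ₗ[ℝ] PowerSeries P}
    (h : IsContactPair Φ Ψ) (n : ℕ) (K : PowerSeries P)
    (hK : ∀ c, (PowerSeries.X : PowerSeries P) ^ (n + 1) ∣ Φ (x c) - contactFlow K (x c)) :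
    ∃ K' : PowerSeries P, PowerSeries.X ^ n ∣ K' - K ∧
      ∀ c, (PowerSeries.X : PowerSeries P) ^ (n + 2) ∣ Φ (x c) - contactFlow K' (x c) := by
  have hE := isContactPair_contactFlow K
  obtain ⟨k, hk⟩ := ((isContactPair_contactFlow (-K)).comp h).exists_leading
    (n := n + 1) (Nat.succ_ne_zero n) fun c => by
      have := (isContactPair_contactFlow (-K)).X_pow_dvd (hK c)
      rwa [map_sub, contactFlow_neg_contactFlow] at this
  refine ⟨K + PowerSeries.X ^ n * PowerSeries.C k, by simp, fun c => ?_⟩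
  have h1 := hE.X_pow_dvd (hk c)
  rw [map_sub, map_sub, LinearMap.comp_apply, contactFlow_contactFlow_neg,
    hE.map_X_pow_mul] at h1
  have h2 := contactFlow_add K (PowerSeries.C k) (x c) n
  have h3 : (PowerSeries.X : PowerSeries P) ^ (n + 2) ∣
      PowerSeries.X ^ (n + 1) * (contactFlow K (cderiv (PowerSeries.C k) (x c)) -
        cderiv (PowerSeries.C k) (x c)) := by
    rw [show n + 2 = n + 1 + 1 from rfl, pow_succ _ (n + 1)]
    exact mul_dvd_mul_left _ (hE.dvd_sub _)
  convert dvd_add (_root_.dvd_sub h1 h2) h3 using 1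
  ring

/-- Every formal contact transformation near the identity is the time-`τ` flow of a formal
Hamiltonian. -/
theorem IsContactPair.exists_contactFlow {Φ Ψ : PowerSeries P →ₗ[ℝ] PowerSeries P}
    (h : IsContactPair Φ Ψ) :
    ∃ K : PowerSeries P, ∀ c, contactFlow K (x c) = Φ (x c) := by
  let S : ℕ → Type _ := fun n => { K : PowerSeries P //
    ∀ c, (PowerSeries.X : PowerSeries P) ^ (n + 1) ∣ Φ (x c) - contactFlow K (x c) }
  let K0 : S 0 := ⟨0, fun c => by
    have h1 := h.dvd_sub (x c)
    have h2 := (isContactPair_contactFlow (0 : PowerSeries P)).dvd_sub (x c)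
    simpa using _root_.dvd_sub h1 h2⟩
  choose next hnext1 hnext2 using fun (n : ℕ) (K : S n) => h.exists_step n K.1 K.2
  let seq : ∀ n, S n := fun n => Nat.rec K0 (fun n K => ⟨next n K, hnext2 n K⟩) n
  have hseq : ∀ n, PowerSeries.X ^ n ∣ (seq (n + 1)).1 - (seq n).1 := fun n => hnext1 n (seq n)
  -- Passing from stage j to j+1 changes only coefficients of index at least j, so coefficient n is
  -- frozen from stage n+1. The limit collects these frozen values.
  have hcoeff : ∀ n m, PowerSeries.coeff n (seq (n + 1 + m)).1 =
      PowerSeries.coeff n (seq (n + 1)).1 := by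
    intro n m
    induction m with
    | zero => rfl
    | succ m ih =>
      have := PowerSeries.X_pow_dvd_iff.1 (hseq (n + 1 + m)) n (by omega)
      rw [map_sub, sub_eq_zero] at this
      rw [← ih]
      exact this
  refine ⟨PowerSeries.mk fun n => PowerSeries.coeff n (seq (n + 1)).1, fun c => ?_⟩
  refine eq_of_forall_X_pow_dvd_sub fun N => ?_
  have h1 := (seq N).2 c
  have h2 : PowerSeries.X ^ N ∣
      (PowerSeries.mk fun n => PowerSeries.coeff n (seq (n + 1)).1) - (seq N).1 := by
    rw [PowerSeries.X_pow_dvd_iff]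
    intro m hm
    obtain ⟨j, rfl⟩ := Nat.exists_eq_add_of_le (Nat.succ_le_of_lt hm)
    rw [map_sub, PowerSeries.coeff_mk, hcoeff m j, sub_self]
  have h3 := _root_.dvd_sub (X_pow_dvd_contactFlow_sub h2 (x c)) h1
  refine (pow_dvd_pow _ (Nat.le_succ N)).trans ?_
  convert h3 using 1
  ring

/-! ### Functoriality -/

/-- A homomorphism that respects the derivations and the coordinates. -/
structure IsDarbouxHom (θ : P →ₐ[ℝ] Q) : Prop where
  map_d : ∀ c f, θ (d c f) = d c (θ f)
  map_x : ∀ c, θ (x c) = x c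

/-- Stated for any series g because the linearization in β needs it for (e^x-1)/x as well as for the
exponential. -/
theorem IsDarbouxHom.map_funCalc_contactOp {θ : P →ₐ[ℝ] Q} (hθ : IsDarbouxHom θ)
    (g : PowerSeries ℝ) (K F : PowerSeries P) :
    PowerSeries.map (θ : P →+* Q) (funCalc g (contactOp K) F) =
      funCalc g (contactOp (PowerSeries.map (θ : P →+* Q) K)) (PowerSeries.map (θ : P →+* Q) F) := by
  have hd : ∀ (c : Fin 3) (F : PowerSeries P), PowerSeries.map (θ : P →+* Q) (d c F) =
      d c (PowerSeries.map (θ : P →+* Q) F) := fun c F => by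
    ext n
    simp [coeff_d, hθ.map_d]
  refine funCalc_intertwine _ (fun _ => θ) (fun _ => map_add θ) (fun _ => map_smul θ)
    (fun n F => by simp) (fun F => ?_) F
  simp [contactOp_apply, cderiv, hd, x_powerSeries, hθ.map_x]

theorem IsDarbouxHom.map_contactFlow {θ : P →ₐ[ℝ] Q} (hθ : IsDarbouxHom θ)
    (K F : PowerSeries P) :
    PowerSeries.map (θ : P →+* Q) (contactFlow K F) =
      contactFlow (PowerSeries.map (θ : P →+* Q) K) (PowerSeries.map (θ : P →+* Q) F) :=
  hθ.map_funCalc_contactOp _ K F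

theorem d_rescale (r : ℝ) (c : Fin 3) (F : PowerSeries P) :
    d c (PowerSeries.rescale (algebraMap ℝ P r) F) =
      PowerSeries.rescale (algebraMap ℝ P r) (d c F) := by
  ext n
  rw [coeff_d, PowerSeries.coeff_rescale, PowerSeries.coeff_rescale, coeff_d, ← map_pow,
    ← Algebra.smul_def, ← Algebra.smul_def, map_smul]

/-- Substituting rτ for τ turns τX_{K(τ)} into τX_{rK(rτ)}. This is the source both of homogeneity
in the parameters and of time reversal. -/
theorem rescale_contactFlow (r : ℝ) (K F : PowerSeries P) :
    PowerSeries.rescale (algebraMap ℝ P r) (contactFlow K F) =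
      contactFlow (r • PowerSeries.rescale (algebraMap ℝ P r) K)
        (PowerSeries.rescale (algebraMap ℝ P r) F) := by
  refine funCalc_intertwine (θ := fun F => PowerSeries.rescale (algebraMap ℝ P r) F) _
    (fun n a => algebraMap ℝ P r ^ n * a) (fun _ _ _ => mul_add _ _ _)
    (fun _ _ _ => mul_smul_comm _ _ _)
    (fun n F => by rw [PowerSeries.coeff_rescale]) (fun F => ?_) F
  have hX : PowerSeries.rescale (algebraMap ℝ P r) PowerSeries.X =
      r • (PowerSeries.X : PowerSeries P) := by
    rw [PowerSeries.rescale_X]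
    ext n
    rw [PowerSeries.coeff_C_mul, coeff_real_smul, Algebra.smul_def]
  rw [contactOp_apply, contactOp_apply, cderiv_smul_left, map_mul, hX]
  simp only [cderiv, map_add, map_sub, map_mul, ← d_rescale, x_powerSeries, rescale_C']
  rw [smul_mul_assoc, mul_smul_comm]

end DarbouxRing

namespace DarbouxRing

/-! ### The Darboux rings of the van der Pol problem -/

noncomputable instance : DarbouxRing PhasePoly where
  d c := (MvPolynomial.pderiv c).toLinearMap
  d_mul c f g := by
    simp only [Derivation.coeFn_coe, Derivation.leibniz, smul_eq_mul]
    ring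
  d_comm c c' f := by
    have h : ⁅(MvPolynomial.pderiv c : Derivation ℝ PhasePoly PhasePoly),
        (MvPolynomial.pderiv c' : Derivation ℝ PhasePoly PhasePoly)⁆ = 0 := by
      refine MvPolynomial.derivation_ext fun i => ?_
      rw [Derivation.commutator_apply, MvPolynomial.pderiv_X, MvPolynomial.pderiv_X]
      by_cases h1 : c = i <;> by_cases h2 : c' = i <;> simp [h1, h2]
    have := congrArg (fun D : Derivation ℝ PhasePoly PhasePoly => D f) h
    simpa [Derivation.commutator_apply, sub_eq_zero] using this
  x := MvPolynomial.X
  d_x c c' := by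
    simp [MvPolynomial.pderiv_X, Pi.single_apply, eq_comm]

theorem d_phasePoly (c : Fin 3) (f : PhasePoly) : d c f = MvPolynomial.pderiv c f := rfl

theorem x_phasePoly (c : Fin 3) : (x c : PhasePoly) = MvPolynomial.X c := rfl

theorem coeff_sum_monomial_linear {P : Type*} [CommRing P] [Algebra ℝ P] (D : P →ₗ[ℝ] P) (f : Polynomial P) (k : ℕ) :
    (f.sum fun n a => Polynomial.monomial n (D a)).coeff k = D (f.coeff k) := by
  rw [Polynomial.sum, Polynomial.finsetSum_coeff]
  simp only [Polynomial.coeff_monomial]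
  rw [Finset.sum_ite_eq' f.support k fun n => D (f.coeff n)]
  split_ifs with h
  · rfl
  · rw [Polynomial.notMem_support_iff.1 h, map_zero]

theorem smul_powerSeries_C {P : Type*} [CommRing P] [Algebra ℝ P] (r : ℝ) (a : P) :
    r • PowerSeries.C a = PowerSeries.C (r • a) := by
  ext n
  rw [coeff_real_smul, PowerSeries.coeff_C, PowerSeries.coeff_C]
  split_ifs <;> simp

/-! ### Adjoining a constant parameter to a Darboux ring. -/

section Polynomial

variable {P : Type*} [CommRing P] [Algebra ℝ P] [DarbouxRing P]

noncomputable instance : DarbouxRing (Polynomial P) where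
  d c :=
    { toFun := fun f => f.sum fun n a => Polynomial.monomial n (d c a)
      map_add' := fun f g => by
        ext k
        simp only [coeff_sum_monomial_linear, Polynomial.coeff_add, map_add]
      map_smul' := fun r f => by
        ext k
        simp only [coeff_sum_monomial_linear, Polynomial.coeff_smul, map_smul, RingHom.id_apply] }
  d_mul c f g := by
    ext k
    simp only [LinearMap.coe_mk, AddHom.coe_mk, coeff_sum_monomial_linear, Polynomial.coeff_mul,
      Polynomial.coeff_add, map_sum, d_mul, Finset.sum_add_distrib]
  d_comm c c' f := by
    ext k
    simp only [LinearMap.coe_mk, AddHom.coe_mk, coeff_sum_monomial_linear, d_comm c c']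
  x c := Polynomial.C (x c)
  d_x c c' := by
    ext k
    simp only [LinearMap.coe_mk, AddHom.coe_mk, coeff_sum_monomial_linear, Polynomial.coeff_C]
    by_cases h : c = c' <;> by_cases hk : k = 0 <;> simp [h, hk, d_x, Polynomial.coeff_one]

theorem polynomial_coeff_d (c : Fin 3) (f : Polynomial P) (k : ℕ) :
    (d c f).coeff k = d c (f.coeff k) := coeff_sum_monomial_linear (d c) f k

theorem x_polynomial (c : Fin 3) : (x c : Polynomial P) = Polynomial.C (x c) := rfl

theorem d_polynomial_X (c : Fin 3) : d c (Polynomial.X : Polynomial P) = 0 := by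
  ext k
  rw [polynomial_coeff_d, Polynomial.coeff_X]
  split_ifs <;> simp [d_one]

theorem d_polynomial_C (c : Fin 3) (a : P) : d c (Polynomial.C a) = Polynomial.C (d c a) := by
  ext k
  rw [polynomial_coeff_d, Polynomial.coeff_C, Polynomial.coeff_C]
  split_ifs <;> simp

end Polynomial

/-- Evaluation of the parameter at a real number. -/
noncomputable def evalParam (e : ℝ) : Polynomial PhasePoly →ₐ[ℝ] PhasePoly where
  toRingHom := Polynomial.evalRingHom (MvPolynomial.C e)
  commutes' r := by
    simp [Polynomial.algebraMap_apply]

theorem evalParam_apply (e : ℝ) (f : Polynomial PhasePoly) :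
    evalParam e f = f.eval (MvPolynomial.C e) := rfl

theorem isDarbouxHom_evalParam (e : ℝ) : IsDarbouxHom (evalParam e) where
  map_d c f := by
    have hC : ∀ c : Fin 3, d c (MvPolynomial.C e : PhasePoly) = 0 := fun c => by
      rw [d_phasePoly, MvPolynomial.pderiv_C]
    induction f using Polynomial.induction_on' with
    | add f g hf hg => simp only [map_add, hf, hg]
    | monomial n a =>
      have hX : d c ((Polynomial.X : Polynomial PhasePoly) ^ n) = 0 :=
        d_pow_of_eq_zero (d_polynomial_X c) n
      rw [← Polynomial.C_mul_X_pow_eq_monomial, d_mul, hX, d_polynomial_C, mul_zero, add_zero]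
      simp only [evalParam_apply, Polynomial.eval_mul, Polynomial.eval_C, Polynomial.eval_pow,
        Polynomial.eval_X, d_mul, d_pow_of_eq_zero (hC c), mul_zero, add_zero]
  map_x c := by
    rw [evalParam_apply, x_polynomial, Polynomial.eval_C]

/-! ### Words in the three parts of the Hamiltonian -/

variable {P Q : Type*} [CommRing P] [Algebra ℝ P] [DarbouxRing P]
  [CommRing Q] [Algebra ℝ Q] [DarbouxRing Q]

/-- The parts of the Hamiltonian, the first with parameter `α`, the other two with parameter
`β`. -/
noncomputable def partHam (α β : P) : VdPPart → P
  | .A => -(α * ((1 - x 0 ^ 2) * x 2))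
  | .B => β * x 0
  | .C => β * (x 1 * x 2)

/-- The formal composition of the flows of the parts of the Hamiltonian along a word. -/
noncomputable def wordOp (α β : P) : List (VdPPart × ℝ) → PowerSeries P →ₗ[ℝ] PowerSeries P
  | [] => LinearMap.id
  | p :: W => wordOp α β W ∘ₗ contactFlow (PowerSeries.C (p.2 • partHam α β p.1))

theorem wordOp_nil (α β : P) (F : PowerSeries P) : wordOp α β [] F = F := rfl

theorem wordOp_cons (α β : P) (p : VdPPart × ℝ) (W : List (VdPPart × ℝ)) (F : PowerSeries P) :
    wordOp α β (p :: W) F =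
      wordOp α β W (contactFlow (PowerSeries.C (p.2 • partHam α β p.1)) F) := rfl

theorem wordOp_append (α β : P) (W W' : List (VdPPart × ℝ)) (F : PowerSeries P) :
    wordOp α β (W ++ W') F = wordOp α β W' (wordOp α β W F) := by
  induction W generalizing F with
  | nil => rfl
  | cons p W ih => rw [List.cons_append, wordOp_cons, wordOp_cons, ih]

theorem exists_isContactPair_wordOp (α β : P) (W : List (VdPPart × ℝ)) :
    ∃ Ψ, IsContactPair (wordOp α β W) Ψ := by
  induction W with
  | nil => exact ⟨_, IsContactPair.id⟩
  | cons p W ih =>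
    obtain ⟨Ψ, hΨ⟩ := ih
    exact ⟨_, hΨ.comp (isContactPair_contactFlow _)⟩

/-- Every word of flows has a formal Hamiltonian. -/
theorem exists_contactFlow_eq_wordOp (α β : P) (W : List (VdPPart × ℝ)) :
    ∃ K : PowerSeries P, ∀ c, contactFlow K (x c) = wordOp α β W (x c) := by
  obtain ⟨Ψ, hΨ⟩ := exists_isContactPair_wordOp α β W
  exact hΨ.exists_contactFlow

theorem IsDarbouxHom.map_partHam {θ : P →ₐ[ℝ] Q} (hθ : IsDarbouxHom θ) (α β : P) (v : VdPPart) :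
    θ (partHam α β v) = partHam (θ α) (θ β) v := by
  cases v <;> simp [partHam, hθ.map_x]

theorem IsDarbouxHom.map_wordOp {θ : P →ₐ[ℝ] Q} (hθ : IsDarbouxHom θ) (α β : P)
    (W : List (VdPPart × ℝ)) (F : PowerSeries P) :
    PowerSeries.map (θ : P →+* Q) (wordOp α β W F) =
      wordOp (θ α) (θ β) W (PowerSeries.map (θ : P →+* Q) F) := by
  induction W generalizing F with
  | nil => rfl
  | cons p W ih =>
    rw [wordOp_cons, wordOp_cons, ih, hθ.map_contactFlow, PowerSeries.map_C]
    congr 4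
    rw [← hθ.map_partHam]
    exact map_smul θ _ _

theorem IsDarbouxHom.map_x_powerSeries {θ : P →ₐ[ℝ] Q} (hθ : IsDarbouxHom θ) (c : Fin 3) :
    PowerSeries.map (θ : P →+* Q) (x c) = x c := by
  rw [x_powerSeries, x_powerSeries, PowerSeries.map_C, ← hθ.map_x]
  rfl

theorem smul_partHam (r : ℝ) (α β : P) (v : VdPPart) :
    r • partHam α β v = partHam (r • α) (r • β) v := by
  cases v <;> simp [partHam]

theorem rescale_wordOp (r : ℝ) (α β : P) (W : List (VdPPart × ℝ)) (F : PowerSeries P) :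
    PowerSeries.rescale (algebraMap ℝ P r) (wordOp α β W F) =
      wordOp (r • α) (r • β) W (PowerSeries.rescale (algebraMap ℝ P r) F) := by
  induction W generalizing F with
  | nil => rfl
  | cons p W ih =>
    rw [wordOp_cons, wordOp_cons, ih, rescale_contactFlow, rescale_C', smul_powerSeries_C,
      smul_comm, smul_partHam]

theorem rescale_x (r : P) (c : Fin 3) : PowerSeries.rescale r (x c) = (x c : PowerSeries P) :=
  rescale_C' _ _

/-- The formal Hamiltonian of a word under a common rescaling of both parameters. -/
theorem contactFlow_rescale_eq_wordOp {α β : P} {W : List (VdPPart × ℝ)} {K : PowerSeries P}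
    (hK : ∀ c, contactFlow K (x c) = wordOp α β W (x c)) (r : ℝ) (c : Fin 3) :
    contactFlow (r • PowerSeries.rescale (algebraMap ℝ P r) K) (x c) =
      wordOp (r • α) (r • β) W (x c) := by
  have h1 := rescale_contactFlow r K (x c)
  have h2 := rescale_wordOp r α β W (x c)
  rw [rescale_x] at h1 h2
  rw [← h1, ← h2, hK]

/-- The word of the inverse map. -/
def invWord (W : List (VdPPart × ℝ)) : List (VdPPart × ℝ) :=
  (W.map fun p => (p.1, -p.2)).reverse

theorem wordOp_invWord (α β : P) (W : List (VdPPart × ℝ)) (F : PowerSeries P) :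
    wordOp α β (invWord W) (wordOp α β W F) = F := by
  induction W generalizing F with
  | nil => rfl
  | cons p W ih =>
    rw [invWord, List.map_cons, List.reverse_cons, wordOp_append, wordOp_cons, wordOp_cons,
      wordOp_nil]
    rw [invWord] at ih
    rw [ih]
    simp only [neg_smul, map_neg]
    exact contactFlow_neg_contactFlow _ _

theorem wordOp_map_neg (α β : P) (W : List (VdPPart × ℝ)) (F : PowerSeries P) :
    wordOp α β (W.map fun p => (p.1, -p.2)) F = wordOp ((-1 : ℝ) • α) ((-1 : ℝ) • β) W F := by
  induction W generalizing F with
  | nil => rfl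
  | cons p W ih =>
    rw [List.map_cons, wordOp_cons, wordOp_cons, ih, ← smul_partHam, smul_smul, mul_neg_one]

/-- On power series over `ℝ[q, p, s]`, a formal contact transformation is determined by the images
of the coordinates. -/
theorem IsContactPair.eq_of_coordinates
    {Φ Ψ Φ' Ψ' : PowerSeries PhasePoly →ₗ[ℝ] PowerSeries PhasePoly}
    (h : IsContactPair Φ Ψ) (h' : IsContactPair Φ' Ψ') (hx : ∀ c, Φ (x c) = Φ' (x c))
    (F : PowerSeries PhasePoly) : Φ F = Φ' F := by
  have hC : ∀ f : PhasePoly, Φ (PowerSeries.C f) = Φ' (PowerSeries.C f) := by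
    intro f
    induction f using MvPolynomial.induction_on with
    | C a =>
      have e : (PowerSeries.C (MvPolynomial.C a) : PowerSeries PhasePoly) = a • 1 := by
        rw [← _root_.map_one PowerSeries.C, smul_powerSeries_C]
        simp [MvPolynomial.smul_eq_C_mul]
      rw [e, map_smul, map_smul, h.map_one, h'.map_one]
    | add f g hf hg => rw [map_add, map_add, map_add, hf, hg]
    | mul_X f c hf =>
      rw [_root_.map_mul, h.map_mul, h'.map_mul, hf, ← x_phasePoly, ← x_powerSeries, hx]
  refine eq_of_forall_X_pow_dvd_sub fun N => ?_
  induction N generalizing F with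
  | zero => simp
  | succ N ih =>
    -- Both maps fix X and agree on constants. Splitting off the constant term gains one power of X,
    -- with the induction hypothesis applied to the shifted series.
    have e := PowerSeries.eq_X_mul_shift_add_const F
    rw [e, map_add, map_add, h.map_mul, h'.map_mul, h.map_X, h'.map_X, hC, add_sub_add_right_eq_sub,
      ← mul_sub, pow_succ']
    exact mul_dvd_mul_left _ (ih _)

/-- The formal Hamiltonian of a palindromic word is even in `τ`. -/
theorem coeff_eq_zero_of_odd {α β : PhasePoly} {W : List (VdPPart × ℝ)} (hW : W.reverse = W)
    {K : PowerSeries PhasePoly} (hK : ∀ c, contactFlow K (x c) = wordOp α β W (x c))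
    {k : ℕ} (hk : Odd k) : PowerSeries.coeff k K = 0 := by
  obtain ⟨Ψ, hΨ⟩ := exists_isContactPair_wordOp α β W
  have hall := (isContactPair_contactFlow K).eq_of_coordinates hΨ hK
  have hinv : invWord W = W.map fun p => (p.1, -p.2) := by
    rw [invWord, ← List.map_reverse, hW]
  -- The left side is the inverse of the word. Reversing a palindrome changes nothing, so the
  -- inverse is the word with negated weights, whose Hamiltonian is -K(-τ).
  have h1 : ∀ c, contactFlow (-K) (x c) =
      contactFlow ((-1 : ℝ) • PowerSeries.rescale (algebraMap ℝ PhasePoly (-1)) K) (x c) := by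
    intro c
    rw [contactFlow_rescale_eq_wordOp hK, ← wordOp_map_neg, ← hinv,
      ← wordOp_invWord α β W (contactFlow (-K) (x c)), ← hall, contactFlow_contactFlow_neg]
  have h2 := congrArg (PowerSeries.coeff k) (contactFlow_injective h1)
  rw [map_neg, coeff_real_smul, PowerSeries.coeff_rescale, neg_one_smul, neg_inj, map_neg, map_one,
    hk.neg_one_pow] at h2
  have h3 : (2 : ℝ) • PowerSeries.coeff k K = 0 := by
    rw [two_smul]
    nth_rewrite 1 [h2]
    ring
  exact (smul_eq_zero.1 h3).resolve_left two_ne_zero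

end DarbouxRing

/-! ### Bernoulli numbers -/

/-- Euler's formula makes ζ(2k) a multiple of B_{2k}, and the zeta series has nonnegative terms with
the term at 1 equal to 1. -/
theorem bernoulli_two_mul_ne_zero {k : ℕ} (hk : k ≠ 0) : bernoulli (2 * k) ≠ 0 := by
  intro h
  have h1 := hasSum_zeta_nat hk
  rw [h] at h1
  simp only [Rat.cast_zero, mul_zero, zero_div] at h1
  have h2 := (hasSum_zero_iff_of_nonneg (f := fun n : ℕ => 1 / (n : ℝ) ^ (2 * k))
    (fun n => by positivity)).1 h1
  have h3 := congrFun h2 1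
  simp at h3

theorem coeff_bernoulliPowerSeries_ne_zero {k : ℕ} (hk : k ≠ 0) :
    PowerSeries.coeff (2 * k) (bernoulliPowerSeries ℝ) ≠ 0 := by
  rw [bernoulliPowerSeries, PowerSeries.coeff_mk]
  have h1 := bernoulli_two_mul_ne_zero hk
  have h2 := Nat.factorial_ne_zero (2 * k)
  rw [map_ne_zero]
  exact div_ne_zero h1 (Nat.cast_ne_zero.2 h2)

/-- `x / (e^x - 1)` times `(e^x + 1) / 2` is `x / 2` times the hyperbolic cotangent of `x / 2`. -/
theorem bernoulliPowerSeries_mul_cosh :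
    bernoulliPowerSeries ℝ * ((2⁻¹ : ℝ) • (PowerSeries.exp ℝ + 1)) =
      (2⁻¹ : ℝ) • PowerSeries.X + bernoulliPowerSeries ℝ := by
  have h := bernoulliPowerSeries_mul_exp_sub_one ℝ
  rw [← h]
  have e : (PowerSeries.exp ℝ + 1 : PowerSeries ℝ) =
      (PowerSeries.exp ℝ - 1) + (2 : ℝ) • 1 := by
    rw [two_smul]; ring
  rw [e, smul_add, smul_smul, inv_mul_cancel₀ two_ne_zero, one_smul, mul_add, mul_one,
    mul_smul_comm]

theorem coeff_bernoulliPowerSeries_mul_cosh_ne_zero {k : ℕ} (hk : k ≠ 0) :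
    PowerSeries.coeff (2 * k)
      (bernoulliPowerSeries ℝ * ((2⁻¹ : ℝ) • (PowerSeries.exp ℝ + 1))) ≠ 0 := by
  rw [bernoulliPowerSeries_mul_cosh, map_add, map_smul, PowerSeries.coeff_X,
    if_neg (by omega), smul_zero, zero_add]
  exact coeff_bernoulliPowerSeries_ne_zero hk

/-- `x / (e^x - 1)` times `e^(x/2)` is `x / 2` divided by the hyperbolic sine of `x / 2`. -/
theorem bernoulliPowerSeries_mul_exp_half :
    bernoulliPowerSeries ℝ * PowerSeries.rescale (2⁻¹ : ℝ) (PowerSeries.exp ℝ) =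
      (2 : ℝ) • PowerSeries.rescale (2⁻¹ : ℝ) (bernoulliPowerSeries ℝ) -
        bernoulliPowerSeries ℝ := by
  set b := bernoulliPowerSeries ℝ
  set e := PowerSeries.rescale (2⁻¹ : ℝ) (PowerSeries.exp ℝ)
  have h1 : b * (PowerSeries.exp ℝ - 1) = PowerSeries.X := bernoulliPowerSeries_mul_exp_sub_one ℝ
  have h2 : (2 : ℝ) • PowerSeries.rescale (2⁻¹ : ℝ) b * (e - 1) = PowerSeries.X := by
    have h3 := congrArg (PowerSeries.rescale (2⁻¹ : ℝ)) h1
    rw [map_mul, map_sub, map_one, PowerSeries.rescale_X] at h3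
    rw [smul_mul_assoc, h3, ← PowerSeries.smul_eq_C_mul, smul_smul,
      mul_inv_cancel₀ two_ne_zero, one_smul]
  have h4 : e * e = PowerSeries.exp ℝ := by
    rw [PowerSeries.exp_mul_exp_eq_exp_add]
    norm_num
  have hne : (PowerSeries.exp ℝ - 1 : PowerSeries ℝ) ≠ 0 := fun h => by
    rw [h, mul_zero] at h1
    exact PowerSeries.X_ne_zero h1.symm
  refine mul_right_cancel₀ hne ?_
  rw [← h4] at h1 ⊢
  linear_combination (e + 1) * h1 - (e + 1) * h2

theorem coeff_bernoulliPowerSeries_mul_exp_half_ne_zero {k : ℕ} (hk : k ≠ 0) :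
    PowerSeries.coeff (2 * k)
      (bernoulliPowerSeries ℝ * PowerSeries.rescale (2⁻¹ : ℝ) (PowerSeries.exp ℝ)) ≠ 0 := by
  rw [bernoulliPowerSeries_mul_exp_half, map_sub, map_smul, PowerSeries.coeff_rescale, smul_eq_mul,
    ← mul_assoc, ← sub_one_mul]
  refine mul_ne_zero ?_ (coeff_bernoulliPowerSeries_ne_zero hk)
  -- The coefficient is (2·2^(-2k) - 1) times a nonzero Bernoulli coefficient; the first factor is
  -- at most -1/2.
  have h : (2⁻¹ : ℝ) ^ (2 * k) ≤ 2⁻¹ ^ 2 :=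
    pow_le_pow_of_le_one (by norm_num) (by norm_num) (by omega)
  intro h0
  norm_num at h
  linarith

/-! ### Polynomials in a parameter -/

/-- Infinitely many evaluation points determine a polynomial over a domain. Positive values suffice,
so order conditions known only for ε > 0 yield identities for all ε. -/
theorem eq_of_eval_C_eq {p q : Polynomial PhasePoly}
    (h : ∀ e : ℝ, 0 < e → p.eval (MvPolynomial.C e) = q.eval (MvPolynomial.C e)) : p = q := by
  refine Polynomial.eq_of_infinite_eval_eq p q (Set.Infinite.mono ?_
    ((Set.Ioi_infinite (0 : ℝ)).image (f := fun e => (MvPolynomial.C e : PhasePoly))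
      (MvPolynomial.C_injective _ _).injOn))
  rintro _ ⟨e, he, rfl⟩
  exact h e he

/-- If `p(e) = eⁿ q(1/e)` for all `e`, then the coefficients of `p` are those of `q` in reverse
order. -/
theorem coeff_of_eval_inv {p q : Polynomial PhasePoly} {n : ℕ}
    (h : ∀ e : ℝ, 0 < e → p.eval (MvPolynomial.C e) =
      MvPolynomial.C e ^ n * q.eval (MvPolynomial.C e⁻¹)) :
    (∀ j, n < j → p.coeff j = 0) ∧ ∀ i ≤ n, p.coeff (n - i) = q.coeff i := by
  -- The relation cleared of denominators through the reversed polynomial, so that it becomes an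
  -- identity of polynomials that can be checked at positive e.
  have key : Polynomial.X ^ q.natDegree * p = Polynomial.X ^ n * q.reverse := by
    refine eq_of_eval_C_eq fun e he => ?_
    have hinv : (MvPolynomial.C e : PhasePoly) * MvPolynomial.C e⁻¹ = 1 := by
      rw [← map_mul, mul_inv_cancel₀ he.ne', map_one]
    let _ : Invertible (MvPolynomial.C e⁻¹ : PhasePoly) :=
      ⟨MvPolynomial.C e, hinv, by rw [mul_comm, hinv]⟩
    have h1 : Polynomial.eval (MvPolynomial.C e) q.reverse *
        MvPolynomial.C e⁻¹ ^ q.natDegree = Polynomial.eval (MvPolynomial.C e⁻¹) q :=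
      Polynomial.eval₂_reverse_mul_pow (RingHom.id PhasePoly) (MvPolynomial.C e⁻¹) q
    simp only [Polynomial.eval_mul, Polynomial.eval_pow, Polynomial.eval_X]
    rw [h e he, ← h1]
    have h2 : (MvPolynomial.C e : PhasePoly) ^ q.natDegree *
        MvPolynomial.C e⁻¹ ^ q.natDegree = 1 := by
      rw [← mul_pow, hinv, one_pow]
    linear_combination (MvPolynomial.C e ^ n * Polynomial.eval (MvPolynomial.C e) q.reverse) * h2
  have hc : ∀ j, p.coeff j = if n ≤ j + q.natDegree then
      q.coeff (Polynomial.revAt q.natDegree (j + q.natDegree - n)) else 0 := fun j => by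
    have := congrArg (fun r => Polynomial.coeff r (j + q.natDegree)) key
    simp only [Polynomial.coeff_X_pow_mul', Polynomial.coeff_reverse] at this
    rwa [if_pos (Nat.le_add_left _ _), Nat.add_sub_cancel] at this
  constructor
  · intro j hj
    rw [hc, if_pos (by omega), Polynomial.revAt_eq_self_of_lt (by omega)]
    exact Polynomial.coeff_eq_zero_of_natDegree_lt (by omega)
  · intro i hi
    rw [hc]
    split_ifs with h1
    · rw [Polynomial.revAt_le (by omega)]
      congr 1
      omega
    · exact (Polynomial.coeff_eq_zero_of_natDegree_lt (by omega)).symm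

namespace DarbouxRing

/-! ### More functional calculus -/

section

variable {P : Type*} [CommRing P] [Algebra ℝ P]

theorem funCalc_add_left (g h : PowerSeries ℝ) (D : PowerSeries P →ₗ[ℝ] PowerSeries P)
    (F : PowerSeries P) : funCalc (g + h) D F = funCalc g D F + funCalc h D F := by
  ext n
  simp only [coeff_funCalc, map_add, add_smul, Finset.sum_add_distrib]

theorem funCalc_smul_left (r : ℝ) (g : PowerSeries ℝ) (D : PowerSeries P →ₗ[ℝ] PowerSeries P)
    (F : PowerSeries P) : funCalc (r • g) D F = r • funCalc g D F := by
  ext n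
  simp only [coeff_funCalc, map_smul, coeff_real_smul, Finset.smul_sum, smul_assoc]

theorem funCalc_zero_left (D : PowerSeries P →ₗ[ℝ] PowerSeries P) (F : PowerSeries P) :
    funCalc 0 D F = 0 := by
  ext n
  simp [coeff_funCalc]

theorem funCalc_X {D : PowerSeries P →ₗ[ℝ] PowerSeries P} (hD : RaisesOrder D)
    (F : PowerSeries P) : funCalc PowerSeries.X D F = D F := by
  refine eq_of_forall_X_pow_dvd_sub fun N => ?_
  have h := X_pow_dvd_funCalc_sub hD PowerSeries.X F (Nat.le_add_right N 2)
  rwa [Finset.sum_eq_single 1 (fun m _ hm => by rw [PowerSeries.coeff_X, if_neg hm, zero_smul])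
    (fun h => absurd (Finset.mem_range.2 (by omega)) h), PowerSeries.coeff_one_X, one_smul,
    pow_one] at h

theorem funCalc_mul_of_commute (g : PowerSeries ℝ) {D : PowerSeries P →ₗ[ℝ] PowerSeries P}
    {a : P} (h : ∀ F, D (PowerSeries.C a * F) = PowerSeries.C a * D F) (F : PowerSeries P) :
    funCalc g D (PowerSeries.C a * F) = PowerSeries.C a * funCalc g D F :=
  (funCalc_intertwine (θ := fun F => PowerSeries.C a * F) g (fun _ b => a * b)
    (fun _ _ _ => mul_add _ _ _) (fun _ _ _ => mul_smul_comm _ _ _)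
    (fun _ _ => PowerSeries.coeff_C_mul _ _ _) (fun F => (h F).symm) F).symm

/-- The power series of `(e^x - 1) / x`. -/
noncomputable def expSubOneDiv : PowerSeries ℝ :=
  PowerSeries.mk fun n => (((n + 1).factorial : ℝ))⁻¹

theorem expSubOneDiv_mul_X : expSubOneDiv * PowerSeries.X = PowerSeries.exp ℝ - 1 := by
  ext n
  rcases n with _ | n
  · simp
  · rw [PowerSeries.coeff_succ_mul_X, map_sub, coeff_exp_real, expSubOneDiv, PowerSeries.coeff_mk,
      PowerSeries.coeff_one, if_neg (Nat.succ_ne_zero n), sub_zero]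

theorem bernoulliPowerSeries_mul_expSubOneDiv :
    bernoulliPowerSeries ℝ * expSubOneDiv = 1 := by
  refine mul_right_cancel₀ (PowerSeries.X_ne_zero (R := ℝ)) ?_
  rw [mul_assoc, expSubOneDiv_mul_X, bernoulliPowerSeries_mul_exp_sub_one, one_mul]

/-- Isolating D F exposes the factor β that D F carries when F is the coordinate q, so it can be
cancelled before setting β = 0. -/
theorem opExp_eq_add {D : PowerSeries P →ₗ[ℝ] PowerSeries P} (hD : RaisesOrder D)
    (F : PowerSeries P) : opExp D F = F + funCalc expSubOneDiv D (D F) := by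
  have h : PowerSeries.exp ℝ = 1 + expSubOneDiv * PowerSeries.X := by
    rw [expSubOneDiv_mul_X]; ring
  rw [opExp, h, funCalc_add_left, funCalc_one, funCalc_mul hD, funCalc_X hD]

theorem funCalc_of_apply_eq_zero (g : PowerSeries ℝ) {D : PowerSeries P →ₗ[ℝ] PowerSeries P}
    {F : PowerSeries P} (h : D F = 0) : funCalc g D F = PowerSeries.coeff 0 g • F := by
  ext n
  rw [coeff_funCalc, Finset.sum_eq_single 0]
  · simp
  · intro m _ hm
    obtain ⟨m, rfl⟩ := Nat.exists_eq_succ_of_ne_zero hm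
    simp [pow_succ, h]
  · simp

theorem opExp_of_apply_apply_eq_zero {D : PowerSeries P →ₗ[ℝ] PowerSeries P} (hD : RaisesOrder D)
    {F : PowerSeries P} (h : D (D F) = 0) : opExp D F = F + D F := by
  rw [opExp_eq_add hD, funCalc_of_apply_eq_zero _ h]
  simp [expSubOneDiv]

end

variable {P : Type*} [CommRing P] [Algebra ℝ P] [DarbouxRing P]

theorem contactOp_zero : contactOp (0 : PowerSeries P) = 0 := by
  ext1 F
  rw [contactOp_apply, cderiv]
  simp

theorem contactFlow_zero (F : PowerSeries P) : contactFlow 0 F = F := by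
  rw [contactFlow, contactOp_zero, opExp_zero]

theorem d_powerSeries_C_of_const {a : P} (ha : ∀ c, d c a = 0) (c : Fin 3) :
    d c (PowerSeries.C a) = 0 := by
  rw [d_C, ha, map_zero]

theorem contactOp_smul (r : ℝ) (K : PowerSeries P) : contactOp (r • K) = r • contactOp K := by
  ext1 F
  rw [LinearMap.smul_apply, contactOp_apply, contactOp_apply, cderiv_smul_left, mul_smul_comm]

theorem contactOp_const_mul {a : P} (ha : ∀ c, d c a = 0) (K F : PowerSeries P) :
    contactOp K (PowerSeries.C a * F) = PowerSeries.C a * contactOp K F := by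
  rw [contactOp_apply, contactOp_apply,
    cderiv_mul_right_of_const (d_powerSeries_C_of_const ha)]
  ring

theorem contactFlow_const_mul {a : P} (ha : ∀ c, d c a = 0) (K F : PowerSeries P) :
    contactFlow K (PowerSeries.C a * F) = PowerSeries.C a * contactFlow K F :=
  funCalc_mul_of_commute _ (contactOp_const_mul ha K) F

theorem wordOp_const_mul {a : P} (ha : ∀ c, d c a = 0) (α β : P) (W : List (VdPPart × ℝ))
    (F : PowerSeries P) :
    wordOp α β W (PowerSeries.C a * F) = PowerSeries.C a * wordOp α β W F := by
  induction W generalizing F with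
  | nil => rfl
  | cons p W ih => rw [wordOp_cons, wordOp_cons, contactFlow_const_mul ha, ih]

/-! ### First order in the parameter of `B` and `C` -/

/-- The total weight of `A` in a word. -/
def weightA : List (VdPPart × ℝ) → ℝ
  | [] => 0
  | (.A, w) :: W => w + weightA W
  | (.B, _) :: W => weightA W
  | (.C, _) :: W => weightA W

theorem contactFlow_C_smul (r : ℝ) (h : P) (F : PowerSeries P) :
    contactFlow (PowerSeries.C (r • h)) F =
      funCalc (PowerSeries.rescale r (PowerSeries.exp ℝ)) (contactOp (PowerSeries.C h)) F := by
  rw [contactFlow, ← smul_powerSeries_C, contactOp_smul, opExp, funCalc_smul]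

/-- With B and C switched off, the remaining flows of A commute and their times add up. -/
theorem wordOp_zero_right (α : P) (W : List (VdPPart × ℝ)) (F : PowerSeries P) :
    wordOp α 0 W F = funCalc (PowerSeries.rescale (weightA W) (PowerSeries.exp ℝ))
      (contactOp (PowerSeries.C (partHam α 0 .A))) F := by
  induction W generalizing F with
  | nil =>
    have h : PowerSeries.rescale (0 : ℝ) (PowerSeries.exp ℝ) = 1 := by
      rw [PowerSeries.rescale_zero_apply]; simp
    rw [wordOp_nil, weightA, h, funCalc_one]
  | cons p W ih =>
    obtain ⟨_ | _ | _, w⟩ := p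
    · rw [wordOp_cons, ih, contactFlow_C_smul, ← funCalc_mul (raisesOrder_contactOp _),
        PowerSeries.exp_mul_exp_eq_exp_add, add_comm, weightA]
    · rw [wordOp_cons, weightA, ← ih]
      simp [partHam, contactFlow_zero]
    · rw [wordOp_cons, weightA, ← ih]
      simp [partHam, contactFlow_zero]

/-- The factor of `β` in the `q`-component of a word of flows. -/
noncomputable def linOp (α β : P) : List (VdPPart × ℝ) → PowerSeries P
  | [] => 0
  | (.A, _) :: W => linOp α β W
  | (.B, _) :: W => linOp α β W
  | (.C, w) :: W => linOp α β W + w • wordOp α β W (PowerSeries.X * x 2)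

theorem contactOp_C_x0 (h : P) :
    contactOp (PowerSeries.C h) (x 0) = PowerSeries.X * PowerSeries.C (d 1 h) := by
  rw [contactOp_apply, cderiv_x0, d_C]

/-- Only C moves q, since A and B do not involve p. X_C annihilates s, so each letter C adds exactly
one term wβτs, transported by the letters to its right. -/
theorem wordOp_x0 {α β : P} (hα : ∀ c, d c α = 0) (hβ : ∀ c, d c β = 0)
    (W : List (VdPPart × ℝ)) :
    wordOp α β W (x 0) = x 0 + PowerSeries.C β * linOp α β W := by
  have hx : ∀ c c', d c (x c' : P) = if c = c' then 1 else 0 := d_x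
  induction W with
  | nil => simp [wordOp_nil, linOp]
  | cons p W ih =>
    obtain ⟨_ | _ | _, w⟩ := p
    · rw [wordOp_cons, contactFlow, opExp_of_apply_eq_zero, ih, linOp]
      rw [contactOp_C_x0]
      simp [partHam, d_mul, hα, hx, d_one, pow_two]
    · rw [wordOp_cons, contactFlow, opExp_of_apply_eq_zero, ih, linOp]
      rw [contactOp_C_x0]
      simp [partHam, d_mul, hβ, hx]
    · have h1 : contactOp (PowerSeries.C (w • partHam α β .C)) (x 0) =
          PowerSeries.C β * (w • (PowerSeries.X * x 2)) := by
        rw [contactOp_C_x0, map_smul, ← smul_powerSeries_C, mul_smul_comm, mul_smul_comm]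
        simp [partHam, d_mul, hβ, hx, x_powerSeries]
        congr 1
        ring
      have h2 : contactOp (PowerSeries.C (w • partHam α β .C))
          (contactOp (PowerSeries.C (w • partHam α β .C)) (x 0)) = 0 := by
        rw [h1, contactOp_const_mul hβ, map_smul, contactOp_apply,
          cderiv_mul_right_of_const d_X, cderiv_x2, d_C, x_powerSeries, ← map_mul, ← map_sub]
        have h3 : x 1 * d 1 (w • partHam α β .C) - w • partHam α β .C = 0 := by
          rw [map_smul, mul_smul_comm, ← smul_sub]
          simp [partHam, d_mul, hβ, hx]
          right
          ring
        rw [h3]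
        simp
      rw [wordOp_cons, contactFlow, opExp_of_apply_apply_eq_zero (raisesOrder_contactOp _) h2,
        map_add, ih, h1, wordOp_const_mul hβ, map_smul, linOp]
      ring

/-- The power series `∑ w e^{a x}` over the letters `C` of a word, where `w` is the weight of the
letter and `a` the total weight of `A` to its right. -/
noncomputable def linSeries : List (VdPPart × ℝ) → PowerSeries ℝ
  | [] => 0
  | (.A, _) :: W => linSeries W
  | (.B, _) :: W => linSeries W
  | (.C, w) :: W => linSeries W + w • PowerSeries.rescale (weightA W) (PowerSeries.exp ℝ)

theorem linOp_zero_right (α : P) (W : List (VdPPart × ℝ)) :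
    linOp α 0 W = funCalc (linSeries W) (contactOp (PowerSeries.C (partHam α 0 .A)))
      (PowerSeries.X * x 2) := by
  induction W with
  | nil => rw [linOp, linSeries, funCalc_zero_left]
  | cons p W ih =>
    obtain ⟨_ | _ | _, w⟩ := p
    · rw [linOp, linSeries, ih]
    · rw [linOp, linSeries, ih]
    · rw [linOp, linSeries, ih, funCalc_add_left, funCalc_smul_left, wordOp_zero_right]

theorem IsDarbouxHom.map_linOp {Q : Type*} [CommRing Q] [Algebra ℝ Q] [DarbouxRing Q]
    {θ : P →ₐ[ℝ] Q} (hθ : IsDarbouxHom θ) (α β : P) (W : List (VdPPart × ℝ)) :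
    PowerSeries.map (θ : P →+* Q) (linOp α β W) = linOp (θ α) (θ β) W := by
  have hs : ∀ (r : ℝ) (F : PowerSeries P), PowerSeries.map (θ : P →+* Q) (r • F) =
      r • PowerSeries.map (θ : P →+* Q) F := fun r F => by
    ext n
    simp
  induction W with
  | nil => simp [linOp]
  | cons p W ih =>
    obtain ⟨_ | _ | _, w⟩ := p
    · rw [linOp, linOp, ih]
    · rw [linOp, linOp, ih]
    · rw [linOp, linOp, map_add, ih, hs, hθ.map_wordOp, map_mul, PowerSeries.map_X,
        hθ.map_x_powerSeries]

/-! ### The part of the formal Hamiltonian linear in the parameter of B and C. -/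

section Leading

variable {W : List (VdPPart × ℝ)} {κ : PowerSeries (Polynomial PhasePoly)}

/-- At `β = 0` the formal Hamiltonian is a multiple of `A`. -/
theorem map_evalParam_zero
    (hκ : ∀ c, contactFlow κ (x c) = wordOp 1 Polynomial.X W (x c)) :
    PowerSeries.map (evalParam 0 : Polynomial PhasePoly →+* PhasePoly) κ =
      PowerSeries.C (weightA W • partHam 1 0 .A) := by
  refine contactFlow_injective fun c => ?_
  have h0 := isDarbouxHom_evalParam 0
  have h1 := h0.map_contactFlow κ (x c)
  rw [hκ, h0.map_wordOp, h0.map_x_powerSeries, map_one] at h1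
  have h2 : evalParam 0 Polynomial.X = 0 := by simp [evalParam_apply]
  rw [← h1, h2, wordOp_zero_right, contactFlow_C_smul]

theorem coeff_zero_coeff
    (hκ : ∀ c, contactFlow κ (x c) = wordOp 1 Polynomial.X W (x c)) {k : ℕ} (hk : k ≠ 0) :
    (PowerSeries.coeff k κ).coeff 0 = 0 := by
  have h := congrArg (PowerSeries.coeff k) (map_evalParam_zero hκ)
  rw [PowerSeries.coeff_map, PowerSeries.coeff_C, if_neg hk] at h
  rw [Polynomial.coeff_zero_eq_eval_zero]
  simpa [evalParam_apply] using h

theorem contactOp_pow_partHam (m : ℕ) :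
    ((contactOp (PowerSeries.C (partHam 1 0 .A : PhasePoly))) ^ m) (x 2) =
      PowerSeries.X ^ m * PowerSeries.C ((1 - x 0 ^ 2) ^ m * x 2) := by
  have hx : ∀ c c', d c (x c' : PhasePoly) = if c = c' then 1 else 0 := d_x
  induction m with
  | zero => simp [x_powerSeries]
  | succ m ih =>
    rw [pow_succ', Module.End.mul_apply, ih, contactOp_apply,
      cderiv_mul_right_of_const (d_X_pow m), cderiv_C]
    have h : cderiv (partHam 1 0 .A : PhasePoly) ((1 - x 0 ^ 2) ^ m * x 2) =
        (1 - x 0 ^ 2) ^ (m + 1) * x 2 := by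
      have h1 : ∀ n : ℕ, cderiv (partHam 1 0 .A : PhasePoly) ((1 - x 0 ^ 2) ^ n) = 0 := by
        have h2 : cderiv (partHam 1 0 .A : PhasePoly) (1 - x 0 ^ 2) = 0 := by
          simp [cderiv, partHam, d_mul, hx, d_one, pow_two]
        intro n
        induction n with
        | zero => rw [pow_zero, cderiv_const_right d_one]
        | succ n ih => rw [pow_succ, cderiv_mul_right, ih, h2, zero_mul, mul_zero, add_zero]
      rw [cderiv_mul_right, h1, zero_mul, zero_add, cderiv_x2]
      simp [partHam, d_mul, hx, d_one, pow_two]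
      ring
    rw [h, pow_succ]
    ring

/-- The coefficient of `β` in the formal Hamiltonian of a word of total weight `1`. -/
theorem d_coeff_one_coeff (hW : weightA W = 1)
    (hκ : ∀ c, contactFlow κ (x c) = wordOp 1 Polynomial.X W (x c)) (k : ℕ) :
    d 1 ((PowerSeries.coeff k κ).coeff 1) =
      PowerSeries.coeff k (bernoulliPowerSeries ℝ * linSeries W) •
        ((1 - x 0 ^ 2) ^ k * x 2 : PhasePoly) := by
  have h0 := isDarbouxHom_evalParam 0
  have hA := map_evalParam_zero hκ
  rw [hW, one_smul] at hA
  have hx : ∀ c c', d c (x c' : PhasePoly) = if c = c' then 1 else 0 := d_x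
  have hX0 : evalParam 0 Polynomial.X = 0 := by simp [evalParam_apply]
  set D := contactOp (PowerSeries.C (partHam 1 0 .A : PhasePoly)) with hD
  set Z : PowerSeries (Polynomial PhasePoly) :=
    PowerSeries.mk fun k => (PowerSeries.coeff k (d 1 κ)).divX with hZ
  -- At β = 0 the Hamiltonian is A, which does not involve p. Hence ∂_pκ is divisible by β, and Z is
  -- the quotient.
  have hZκ : d 1 κ = PowerSeries.C Polynomial.X * Z := by
    ext1 n
    rw [PowerSeries.coeff_C_mul, hZ, PowerSeries.coeff_mk]
    conv_lhs => rw [← Polynomial.X_mul_divX_add (PowerSeries.coeff n (d 1 κ))]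
    rw [add_eq_left]
    have h := congrArg (PowerSeries.coeff n) (congrArg (d 1) hA)
    rw [coeff_d, PowerSeries.coeff_map, d_C] at h
    have h1 : d 1 (partHam 1 0 .A : PhasePoly) = 0 := by
      simp [partHam, d_mul, hx, d_one, pow_two]
    rw [h1, map_zero, map_zero] at h
    rw [coeff_d, polynomial_coeff_d, Polynomial.coeff_zero_eq_eval_zero]
    have h2 : Polynomial.eval 0 (PowerSeries.coeff n κ) =
        evalParam 0 (PowerSeries.coeff n κ) := by simp [evalParam_apply]
    rw [h2]
    exact (congrArg Polynomial.C h).trans (map_zero _)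
  -- The q-component of exp(τX_κ) equals that of the word; both sides have the form q plus β times
  -- something.
  have hflow : PowerSeries.C Polynomial.X *
      funCalc expSubOneDiv (contactOp κ) (PowerSeries.X * Z) =
      PowerSeries.C Polynomial.X * linOp 1 Polynomial.X W := by
    have h1 := hκ 0
    rw [wordOp_x0 d_one d_polynomial_X, contactFlow, opExp_eq_add (raisesOrder_contactOp κ),
      contactOp_apply, cderiv_x0, hZκ, mul_left_comm] at h1
    rw [← funCalc_mul_of_commute _ (contactOp_const_mul d_polynomial_X κ)]
    exact add_left_cancel h1
  have hflow' := mul_left_cancel₀ (by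
    intro h
    exact Polynomial.X_ne_zero (PowerSeries.C_injective (h.trans (map_zero _).symm))) hflow
  have h2 := congrArg (PowerSeries.map (evalParam 0 : Polynomial PhasePoly →+* PhasePoly)) hflow'
  rw [h0.map_funCalc_contactOp, h0.map_linOp, hA, map_one, hX0, linOp_zero_right, map_mul,
    PowerSeries.map_X, ← hD] at h2
  -- x/(e^x-1) inverts (e^x-1)/x, so τZ at β = 0 is solved for explicitly.
  have h3 := congrArg (funCalc (bernoulliPowerSeries ℝ) D) h2
  have hr : RaisesOrder D := raisesOrder_contactOp _
  rw [← funCalc_mul hr, ← funCalc_mul hr, bernoulliPowerSeries_mul_expSubOneDiv, funCalc_one] at h3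
  -- The index is shifted because both sides carry an extra factor τ.
  have h4 := congrArg (PowerSeries.coeff (k + 1)) h3
  rw [PowerSeries.coeff_succ_X_mul, PowerSeries.coeff_map, hZ, PowerSeries.coeff_mk] at h4
  have h5 : d 1 ((PowerSeries.coeff k κ).coeff 1) =
      evalParam 0 (PowerSeries.coeff k (d 1 κ)).divX := by
    rw [evalParam_apply, map_zero, ← Polynomial.coeff_zero_eq_eval_zero, Polynomial.coeff_divX,
      coeff_d, polynomial_coeff_d]
  rw [h5]
  refine Eq.trans h4 ?_
  have hpow : ∀ m, (D ^ m) (PowerSeries.X * x 2) =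
      PowerSeries.X ^ (m + 1) * PowerSeries.C ((1 - x 0 ^ 2) ^ m * x 2) := by
    intro m
    have hc : ∀ F, (D ^ m) (PowerSeries.X * F) = PowerSeries.X * (D ^ m) F := by
      induction m with
      | zero => intro F; rfl
      | succ m ih =>
        intro F
        rw [pow_succ, Module.End.mul_apply, Module.End.mul_apply, ← ih, hD, contactOp_apply,
          contactOp_apply, cderiv_mul_right_of_const d_X]
    rw [hc, contactOp_pow_partHam, pow_succ']
    ring
  rw [coeff_funCalc, Finset.sum_eq_single k]
  · rw [hpow, PowerSeries.coeff_X_pow_mul', if_pos le_rfl]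
    simp
  · intro m _ hm
    rw [hpow, PowerSeries.coeff_X_pow_mul']
    split_ifs with h
    · rw [PowerSeries.coeff_C, if_neg (by omega), smul_zero]
    · rw [smul_zero]
  · intro h
    exact absurd (Finset.mem_range.2 (by omega)) h

end Leading

end DarbouxRing

/-! ### Asymptotic expansions, uniform in the base point -/

/-- Evaluation of a polynomial in the step size at `(τ, y)`. -/
noncomputable def polyEval (p : Polynomial PhasePoly) (z : ℝ × Phase) : ℝ :=
  Polynomial.eval₂ (MvPolynomial.eval z.2) z.1 p

theorem polyEval_add (p q : Polynomial PhasePoly) (z : ℝ × Phase) :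
    polyEval (p + q) z = polyEval p z + polyEval q z := Polynomial.eval₂_add _ _

theorem polyEval_sub (p q : Polynomial PhasePoly) (z : ℝ × Phase) :
    polyEval (p - q) z = polyEval p z - polyEval q z := Polynomial.eval₂_sub _

theorem polyEval_mul (p q : Polynomial PhasePoly) (z : ℝ × Phase) :
    polyEval (p * q) z = polyEval p z * polyEval q z := Polynomial.eval₂_mul _ _

theorem polyEval_C (f : PhasePoly) (z : ℝ × Phase) :
    polyEval (Polynomial.C f) z = MvPolynomial.eval z.2 f := Polynomial.eval₂_C _ _

theorem polyEval_X_pow (n : ℕ) (z : ℝ × Phase) :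
    polyEval (Polynomial.X ^ n) z = z.1 ^ n := Polynomial.eval₂_X_pow _ _

theorem polyEval_monomial (n : ℕ) (f : PhasePoly) (z : ℝ × Phase) :
    polyEval (Polynomial.monomial n f) z = MvPolynomial.eval z.2 f * z.1 ^ n :=
  Polynomial.eval₂_monomial _ _

theorem polyEval_zero_left (p : Polynomial PhasePoly) (y : Phase) :
    polyEval p (0, y) = MvPolynomial.eval y (p.coeff 0) := by
  rw [polyEval, Polynomial.eval₂_at_zero]

theorem continuous_polyEval (p : Polynomial PhasePoly) : Continuous (polyEval p) := by
  induction p using Polynomial.induction_on' with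
  | add p q hp hq =>
    exact (hp.add hq).congr fun z => (polyEval_add p q z).symm
  | monomial n f =>
    refine (((MvPolynomial.continuous_eval f).comp continuous_snd).mul
      (continuous_fst.pow n)).congr fun z => ?_
    rw [polyEval_monomial]
    rfl

theorem hasDerivAt_polyEval (p : Polynomial PhasePoly) (t : ℝ) (y : Phase) :
    HasDerivAt (fun t => polyEval p (t, y)) (polyEval p.derivative (t, y)) t := by
  have h := (p.map (MvPolynomial.eval y)).hasDerivAt t
  rw [Polynomial.derivative_map] at h
  simpa only [polyEval, Polynomial.eval_map] using h

theorem tendsto_polyEval (p : Polynomial PhasePoly) {l : Filter Phase} {x : Phase}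
    (hl : l ≤ 𝓝 x) :
    Tendsto (polyEval p) (𝓝 0 ×ˢ l) (𝓝 (polyEval p (0, x))) := by
  have h := (continuous_polyEval p).tendsto (0, x)
  rw [nhds_prod_eq] at h
  exact h.mono_left (Filter.prod_mono le_rfl hl)

theorem polyEval_isBigO_pow {p : Polynomial PhasePoly} {N : ℕ} (hp : Polynomial.X ^ N ∣ p)
    {l : Filter Phase} {x : Phase} (hl : l ≤ 𝓝 x) :
    polyEval p =O[𝓝 0 ×ˢ l] fun z => z.1 ^ N := by
  obtain ⟨q, rfl⟩ := hp
  have h := (tendsto_polyEval q hl).isBigO_one ℝ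
  have h2 := (isBigO_refl (fun z : ℝ × Phase => z.1 ^ N) (𝓝 0 ×ˢ l)).mul h
  simp only [mul_one] at h2
  refine h2.congr_left fun z => ?_
  rw [polyEval_mul, polyEval_X_pow]

/-- `G (τ, y)` has the asymptotic expansion `F` in powers of `τ`, uniformly as `y` tends to the
base point along `l`. -/
def HasExpansion (l : Filter Phase) (G : ℝ × Phase → ℝ) (F : PowerSeries PhasePoly) : Prop :=
  ∀ N : ℕ, ∃ p : Polynomial PhasePoly, PowerSeries.X ^ N ∣ F - (p : PowerSeries PhasePoly) ∧
    (fun z => G z - polyEval p z) =O[𝓝 0 ×ˢ l] fun z => z.1 ^ N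

namespace HasExpansion

variable {l : Filter Phase} {x : Phase} {G H : ℝ × Phase → ℝ} {F E : PowerSeries PhasePoly}

theorem mono {l' : Filter Phase} (h : HasExpansion l G F) (hl : l' ≤ l) : HasExpansion l' G F :=
  fun N => (h N).imp fun _ hp => ⟨hp.1, hp.2.mono (Filter.prod_mono le_rfl hl)⟩

theorem polynomial (p : Polynomial PhasePoly) : HasExpansion l (polyEval p) p := fun N =>
  ⟨p, by simp, by simpa using isBigO_zero _ _⟩

/-- Any representative of F modulo τ^N may replace the one supplied by the definition, because their
difference is τ^N times a function bounded near the base point. -/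
theorem isBigO (h : HasExpansion l G F) (hl : l ≤ 𝓝 x) {N : ℕ} {p : Polynomial PhasePoly}
    (hp : PowerSeries.X ^ N ∣ F - (p : PowerSeries PhasePoly)) :
    (fun z => G z - polyEval p z) =O[𝓝 0 ×ˢ l] fun z => z.1 ^ N := by
  obtain ⟨q, hq, hO⟩ := h N
  have hd : Polynomial.X ^ N ∣ q - p := by
    rw [Polynomial.X_pow_dvd_iff]
    intro m hm
    have := PowerSeries.X_pow_dvd_iff.1 (dvd_sub hp hq) m hm
    simpa using this
  refine (hO.add (polyEval_isBigO_pow hd hl)).congr_left fun z => ?_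
  rw [polyEval_sub]
  ring

theorem add (h : HasExpansion l G F) (h' : HasExpansion l H E) :
    HasExpansion l (fun z => G z + H z) (F + E) := fun N => by
  obtain ⟨p, hp, hO⟩ := h N
  obtain ⟨q, hq, hO'⟩ := h' N
  refine ⟨p + q, ?_, (hO.add hO').congr_left fun z => ?_⟩
  · rw [Polynomial.coe_add]
    convert dvd_add hp hq using 1
    ring
  · rw [polyEval_add]
    ring

theorem isBigO_one (h : HasExpansion l G F) (hl : l ≤ 𝓝 x) :
    G =O[𝓝 0 ×ˢ l] fun _ => (1 : ℝ) := by
  have h0 := h.isBigO hl (N := 0) (p := 0) (by simp)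
  simpa [polyEval] using h0

theorem mul (h : HasExpansion l G F) (h' : HasExpansion l H E) (hl : l ≤ 𝓝 x) :
    HasExpansion l (fun z => G z * H z) (F * E) := fun N => by
  obtain ⟨p, hp, hO⟩ := h N
  obtain ⟨q, hq, hO'⟩ := h' N
  refine ⟨p * q, ?_, ?_⟩
  · rw [Polynomial.coe_mul]
    convert dvd_add (hq.mul_left F) (hp.mul_right (q : PowerSeries PhasePoly)) using 1
    ring
  · have h1 := (h.isBigO_one hl).mul hO'
    have h2 := hO.mul ((tendsto_polyEval q hl).isBigO_one ℝ)
    simp only [one_mul, mul_one] at h1 h2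
    refine (h1.add h2).congr_left fun z => ?_
    rw [polyEval_mul]
    ring

theorem tendsto (h : HasExpansion l G F) (hl : l ≤ 𝓝 x) :
    Tendsto G (𝓝 0 ×ˢ l) (𝓝 (MvPolynomial.eval x (PowerSeries.coeff 0 F))) := by
  obtain ⟨p, hp, hO⟩ := h 1
  have h1 : Tendsto (fun z : ℝ × Phase => z.1 ^ 1) (𝓝 0 ×ˢ l) (𝓝 0) := by
    simpa using (tendsto_fst : Tendsto Prod.fst (𝓝 (0 : ℝ) ×ˢ l) (𝓝 0))
  have h2 := (hO.trans_tendsto h1).add (tendsto_polyEval p hl)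
  have h3 := PowerSeries.X_pow_dvd_iff.1 hp 0 Nat.one_pos
  rw [map_sub, sub_eq_zero, Polynomial.coeff_coe] at h3
  rw [polyEval_zero_left, ← h3, zero_add] at h2
  simpa using h2

theorem isBigO_at (h : HasExpansion l G F) (hl : pure x ≤ l) (N : ℕ) :
    (fun τ : ℝ => G (τ, x) - ∑ n ∈ Finset.range N,
      MvPolynomial.eval x (PowerSeries.coeff n F) * τ ^ n) =O[𝓝 0] fun τ => τ ^ N := by
  have h1 := (h.mono hl).isBigO (pure_le_nhds x) (N := N) (p := PowerSeries.trunc N F) (by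
    rw [PowerSeries.X_pow_dvd_iff]
    intro m hm
    rw [map_sub, Polynomial.coeff_coe, PowerSeries.coeff_trunc, if_pos hm, sub_self])
  rw [Filter.prod_pure, isBigO_map] at h1
  refine h1.congr_left fun τ => ?_
  simp only [Function.comp_apply, polyEval, PowerSeries.eval₂_trunc_eq_sum_range]

end HasExpansion

theorem coeff_eq_zero_of_isBigO {a : ℕ → ℝ} {N : ℕ}
    (h : (fun τ : ℝ => ∑ n ∈ Finset.range N, a n * τ ^ n) =O[𝓝 0] fun τ => τ ^ N) :
    ∀ n < N, a n = 0 := by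
  intro n
  induction n using Nat.strong_induction_on with
  | _ n ih =>
    intro hn
    have hpow : ∀ k, n < k → (fun τ : ℝ => τ ^ k) =o[𝓝 0] fun τ => τ ^ n :=
      fun k hk => isLittleO_pow_pow hk
    have h1 : (fun τ : ℝ => ∑ k ∈ (Finset.range N).erase n, a k * τ ^ k) =o[𝓝 0]
        fun τ => τ ^ n := by
      refine IsLittleO.fun_sum fun k hk => ?_
      rw [Finset.mem_erase, Finset.mem_range] at hk
      rcases lt_or_gt_of_ne hk.1 with h3 | h3
      · simp only [ih k h3 hk.2, zero_mul]
        exact isLittleO_zero _ _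
      · exact (hpow k h3).const_mul_left _
    have h2 : (fun τ : ℝ => a n * τ ^ n) =o[𝓝 0] fun τ => τ ^ n := by
      refine ((h.trans_isLittleO (hpow N hn)).sub h1).congr_left fun τ => ?_
      rw [← Finset.add_sum_erase _ _ (Finset.mem_range.2 hn)]
      ring
    by_contra h0
    refine isLittleO_irrefl ?_ ((isLittleO_const_mul_left_iff h0).1 h2)
    have h3 : ∃ᶠ τ in 𝓝[≠] (0 : ℝ), τ ^ n ≠ 0 :=
      (eventually_mem_nhdsWithin (a := (0 : ℝ)) (s := {0}ᶜ)).frequently.mono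
        fun τ hτ => pow_ne_zero n hτ
    exact h3.filter_mono nhdsWithin_le_nhds

theorem coeff_eq_of_isBigO {G : ℝ → ℝ} {a b : ℕ → ℝ} {N : ℕ}
    (ha : (fun τ : ℝ => G τ - ∑ n ∈ Finset.range N, a n * τ ^ n) =O[𝓝 0] fun τ => τ ^ N)
    (hb : (fun τ : ℝ => G τ - ∑ n ∈ Finset.range N, b n * τ ^ n) =O[𝓝 0] fun τ => τ ^ N) :
    ∀ n < N, a n = b n := by
  intro n hn
  have h := coeff_eq_zero_of_isBigO (a := fun n => b n - a n) (N := N)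
    ((ha.sub hb).congr_left fun τ => by
      simp only [sub_mul, Finset.sum_sub_distrib]
      ring) n hn
  linarith

/-- Composition of asymptotic expansions. -/
theorem HasExpansion.comp {l : Filter Phase} {x₀ : Phase} (hl : l ≤ 𝓝 x₀)
    {Φ Ψ : PowerSeries PhasePoly →ₗ[ℝ] PowerSeries PhasePoly}
    (hΦ : DarbouxRing.IsContactPair Φ Ψ) {S : ℝ × Phase → Phase}
    (hS : ∀ c, HasExpansion l (fun z => S z c) (Φ (x c)))
    {G : ℝ × Phase → ℝ} {F : PowerSeries PhasePoly} (hG : HasExpansion (𝓝 x₀) G F) :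
    HasExpansion l (fun z => G (z.1, S z)) (Φ F) := by
  -- Expansions multiply and Φ is multiplicative, so the expansions of the coordinates propagate to
  -- polynomials, first in the point and then in τ too.
  have hC : ∀ f : PhasePoly, HasExpansion l (fun z => MvPolynomial.eval (S z) f)
      (Φ (PowerSeries.C f)) := by
    intro f
    induction f using MvPolynomial.induction_on with
    | C a =>
      have e : (PowerSeries.C (MvPolynomial.C a) : PowerSeries PhasePoly) = a • 1 := by
        rw [← map_one PowerSeries.C, DarbouxRing.smul_powerSeries_C]
        simp [MvPolynomial.smul_eq_C_mul]
      rw [e, map_smul, hΦ.map_one, ← e, ← Polynomial.coe_C]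
      have e' : (fun z => MvPolynomial.eval (S z) (MvPolynomial.C a)) =
          polyEval (Polynomial.C (MvPolynomial.C a)) := by
        funext z
        rw [polyEval_C, MvPolynomial.eval_C, MvPolynomial.eval_C]
      rw [e']
      exact HasExpansion.polynomial _
    | add f g hf hg => simpa only [map_add] using hf.add hg
    | mul_X f c hf =>
      simp only [map_mul, hΦ.map_mul, MvPolynomial.eval_X]
      exact hf.mul (hS c) hl
  have hp : ∀ p : Polynomial PhasePoly, HasExpansion l (fun z => polyEval p (z.1, S z))
      (Φ (p : PowerSeries PhasePoly)) := by
    intro p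
    induction p using Polynomial.induction_on' with
    | add p q hp hq => simpa only [Polynomial.coe_add, map_add, polyEval_add] using hp.add hq
    | monomial n f =>
      have e : ((Polynomial.monomial n f : Polynomial PhasePoly) : PowerSeries PhasePoly) =
          PowerSeries.X ^ n * PowerSeries.C f := by
        rw [← Polynomial.C_mul_X_pow_eq_monomial, Polynomial.coe_mul, Polynomial.coe_C,
          Polynomial.coe_pow, Polynomial.coe_X, mul_comm]
      rw [e, hΦ.map_X_pow_mul]
      have h1 := (HasExpansion.polynomial (l := l) (Polynomial.X ^ n)).mul (hC f) hl
      simp only [polyEval_X_pow, Polynomial.coe_pow, Polynomial.coe_X] at h1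
      simpa only [polyEval_monomial, mul_comm] using h1
  have hS' : Tendsto S (𝓝 0 ×ˢ l) (𝓝 x₀) := by
    rw [tendsto_pi_nhds]
    intro c
    have h1 := (hS c).tendsto hl
    have h2 := hΦ.dvd_sub (x c)
    rw [PowerSeries.X_dvd_iff, map_sub, sub_eq_zero] at h2
    rw [PowerSeries.coeff_zero_eq_constantCoeff_apply, h2, DarbouxRing.x_powerSeries,
      PowerSeries.constantCoeff_C, DarbouxRing.x_phasePoly, MvPolynomial.eval_X] at h1
    exact h1
  intro N
  obtain ⟨p, hpF, hpO⟩ := hG N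
  obtain ⟨q, hq, hqO⟩ := hp p N
  -- Here uniformity is used: the remainder of G must be controlled at the moving point S(τ, y).
  have ht : Tendsto (fun z : ℝ × Phase => (z.1, S z)) (𝓝 0 ×ˢ l) (𝓝 0 ×ˢ 𝓝 x₀) :=
    tendsto_fst.prodMk hS'
  refine ⟨q, ?_, ((hpO.comp_tendsto ht).add hqO).congr_left fun z => ?_⟩
  · have h1 := hΦ.X_pow_dvd hpF
    rw [map_sub] at h1
    simpa using dvd_add h1 hq
  · simp

/-! ### Expansion of flows -/

theorem hasDerivAt_eval_mvPolynomial {γ : ℝ → Phase} {v : Phase} {t : ℝ}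
    (h : HasDerivAt γ v t) (f : PhasePoly) :
    HasDerivAt (fun t => MvPolynomial.eval (γ t) f)
      (∑ c, v c * MvPolynomial.eval (γ t) (MvPolynomial.pderiv c f)) t := by
  have hc := hasDerivAt_pi.1 h
  induction f using MvPolynomial.induction_on with
  | C a => simpa using hasDerivAt_const t a
  | add f g hf hg =>
    simp only [map_add, mul_add, Finset.sum_add_distrib]
    exact hf.add hg
  | mul_X f i hf =>
    simp only [map_mul, MvPolynomial.eval_X]
    refine (hf.mul (hc i)).congr_deriv (Eq.symm ?_)
    simp only [Derivation.leibniz, smul_eq_mul, map_add, map_mul, MvPolynomial.eval_X,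
      MvPolynomial.pderiv_X, mul_add, Finset.sum_add_distrib, Finset.sum_mul]
    rw [add_comm]
    congr 1
    · exact Finset.sum_congr rfl fun c _ => by ring
    · rw [Finset.sum_eq_single i]
      · simp; ring
      · intro c _ hci
        simp [hci.symm]
      · simp

theorem contactDeriv_eq_cderiv (h g : PhasePoly) : contactDeriv h g = DarbouxRing.cderiv h g := by
  simp [contactDeriv, contactField, Fin.sum_univ_three, DarbouxRing.cderiv,
    DarbouxRing.d_phasePoly, DarbouxRing.x_phasePoly]
  ring

theorem contactOp_C_pow_C (h f : PhasePoly) (m : ℕ) :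
    (DarbouxRing.contactOp (PowerSeries.C h) ^ m) (PowerSeries.C f) =
      PowerSeries.X ^ m * PowerSeries.C ((DarbouxRing.cderiv h)^[m] f) := by
  induction m with
  | zero => simp
  | succ m ih =>
    rw [pow_succ', Module.End.mul_apply, ih, DarbouxRing.contactOp_apply,
      DarbouxRing.cderiv_mul_right_of_const (DarbouxRing.d_X_pow m), DarbouxRing.cderiv_C,
      Function.iterate_succ_apply', pow_succ']
    ring

theorem coeff_contactFlow_C (h f : PhasePoly) (n : ℕ) :
    PowerSeries.coeff n (DarbouxRing.contactFlow (PowerSeries.C h) (PowerSeries.C f)) =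
      ((n.factorial : ℝ))⁻¹ • (DarbouxRing.cderiv h)^[n] f := by
  rw [DarbouxRing.contactFlow, opExp, coeff_funCalc, Finset.sum_eq_single n]
  · rw [contactOp_C_pow_C, PowerSeries.coeff_X_pow_mul', if_pos le_rfl, coeff_exp_real]
    simp
  · intro m hm hmn
    rw [contactOp_C_pow_C, PowerSeries.coeff_X_pow_mul', PowerSeries.coeff_C]
    rw [Finset.mem_range] at hm
    rw [if_pos (by omega), if_neg (by omega), smul_zero]
  · intro h
    exact absurd (Finset.mem_range.2 (Nat.lt_succ_self n)) h

/-- The Taylor polynomial of order `N` in the step size of `f` along the flow of `X_h`. -/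
noncomputable def flowTaylor (h f : PhasePoly) (N : ℕ) : Polynomial PhasePoly :=
  ∑ n ∈ Finset.range N,
    Polynomial.monomial n (((n.factorial : ℝ))⁻¹ • (DarbouxRing.cderiv h)^[n] f)

theorem flowTaylor_derivative (h f : PhasePoly) (N : ℕ) :
    (flowTaylor h f (N + 1)).derivative = flowTaylor h (DarbouxRing.cderiv h f) N := by
  rw [flowTaylor, Finset.sum_range_succ', Polynomial.derivative_add, Polynomial.derivative_sum,
    Polynomial.derivative_monomial]
  simp only [Nat.cast_zero, mul_zero, Polynomial.monomial_zero_right, add_zero]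
  refine Finset.sum_congr rfl fun n _ => ?_
  rw [Polynomial.derivative_monomial, Nat.add_sub_cancel, Function.iterate_succ_apply]
  congr 1
  have h1 : ((n + 1 : ℕ) : PhasePoly) = algebraMap ℝ PhasePoly ((n + 1 : ℕ) : ℝ) := by simp
  rw [h1, mul_comm, ← Algebra.smul_def, smul_smul]
  congr 1
  have := Nat.factorial_ne_zero n
  rw [Nat.factorial_succ]
  push_cast
  field_simp

/-- Differentiation in t replaces f by X_h f both along the flow and in its Taylor polynomial.
Induction on the order, for all f at once, with the mean value inequality gains one power of t. The
filter l allows both flow maps near a point and a single solution. -/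
theorem hasExpansion_flow {φ : ℝ → Phase → Phase} {h : PhasePoly} {l : Filter Phase} {x₀ : Phase}
    (hφ : Tendsto (fun z : ℝ × Phase => φ z.1 z.2) (𝓝 0 ×ˢ l) (𝓝 x₀))
    (h0 : ∀ᶠ y in l, φ 0 y = y)
    (hd : ∀ᶠ z : ℝ × Phase in 𝓝 0 ×ˢ l, HasDerivAt (fun t => φ t z.2)
      (fun c => MvPolynomial.eval (φ z.1 z.2) (contactField h c)) z.1) (f : PhasePoly) :
    HasExpansion l (fun z => MvPolynomial.eval (φ z.1 z.2) f)
      (DarbouxRing.contactFlow (PowerSeries.C h) (PowerSeries.C f)) := by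
  have key : ∀ (N : ℕ) (f : PhasePoly), (fun z : ℝ × Phase => MvPolynomial.eval (φ z.1 z.2) f -
      polyEval (flowTaylor h f N) z) =O[𝓝 0 ×ˢ l] fun z => z.1 ^ N := by
    intro N
    induction N with
    | zero =>
      intro f
      have h1 : Tendsto (fun z : ℝ × Phase => MvPolynomial.eval (φ z.1 z.2) f) (𝓝 0 ×ˢ l)
          (𝓝 (MvPolynomial.eval x₀ f)) :=
        ((MvPolynomial.continuous_eval f).tendsto x₀).comp hφ
      simpa [flowTaylor, polyEval] using h1.isBigO_one ℝ
    | succ N ih =>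
      intro f
      obtain ⟨C, hC0, hC⟩ := (ih (DarbouxRing.cderiv h f)).exists_pos
      have hev := (hC.bound.and hd).and
        ((Filter.eventually_true (𝓝 (0 : ℝ))).prod_mk h0)
      -- A box is chosen so that with (t, y) it contains the whole segment of times up to |t|, with
      -- one constant C for all y.
      obtain ⟨⟨δ, U⟩, ⟨hδ, hU⟩, hall⟩ :=
        ((Metric.nhds_basis_ball (x := (0 : ℝ))).prod l.basis_sets).eventually_iff.1 hev
      refine IsBigO.of_bound C ?_
      refine ((Metric.nhds_basis_ball (x := (0 : ℝ))).prod l.basis_sets).eventually_iff.2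
        ⟨(δ, U), ⟨hδ, hU⟩, ?_⟩
      rintro ⟨t, y⟩ ⟨ht, hy⟩
      have ht' : |t| < δ := by simpa [Real.dist_eq] using ht
      have hmem : ∀ u ∈ Metric.closedBall (0 : ℝ) |t|, (u, y) ∈ Metric.ball (0 : ℝ) δ ×ˢ U := by
        intro u hu
        refine ⟨?_, hy⟩
        have : |u| ≤ |t| := by simpa [Real.dist_eq] using hu
        simpa [Real.dist_eq] using this.trans_lt ht'
      have hder : ∀ u ∈ Metric.closedBall (0 : ℝ) |t|, HasDerivWithinAt
          (fun u => MvPolynomial.eval (φ u y) f - polyEval (flowTaylor h f (N + 1)) (u, y))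
          (MvPolynomial.eval (φ u y) (DarbouxRing.cderiv h f) -
            polyEval (flowTaylor h (DarbouxRing.cderiv h f) N) (u, y))
          (Metric.closedBall (0 : ℝ) |t|) u := by
        intro u hu
        have h1 := hasDerivAt_eval_mvPolynomial (hall (hmem u hu)).1.2 f
        have h2 := hasDerivAt_polyEval (flowTaylor h f (N + 1)) u y
        rw [flowTaylor_derivative] at h2
        have e : ∑ c, MvPolynomial.eval (φ u y) (contactField h c) *
            MvPolynomial.eval (φ u y) (MvPolynomial.pderiv c f) =
            MvPolynomial.eval (φ u y) (DarbouxRing.cderiv h f) := by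
          rw [← contactDeriv_eq_cderiv, contactDeriv, map_sum]
          simp only [map_mul]
        rw [e] at h1
        exact (h1.sub h2).hasDerivWithinAt
      have hbound : ∀ u ∈ Metric.closedBall (0 : ℝ) |t|,
          ‖MvPolynomial.eval (φ u y) (DarbouxRing.cderiv h f) -
            polyEval (flowTaylor h (DarbouxRing.cderiv h f) N) (u, y)‖ ≤ C * |t| ^ N := by
        intro u hu
        refine (hall (hmem u hu)).1.1.trans ?_
        have : |u| ≤ |t| := by simpa [Real.dist_eq] using hu
        rw [norm_pow, Real.norm_eq_abs]
        gcongr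
      have hmv := Convex.norm_image_sub_le_of_norm_hasDerivWithin_le hder hbound
        (convex_closedBall _ _) (Metric.mem_closedBall_self (abs_nonneg t))
        (show t ∈ Metric.closedBall (0 : ℝ) |t| by simp)
      have hzero : MvPolynomial.eval (φ 0 y) f - polyEval (flowTaylor h f (N + 1)) (0, y) = 0 := by
        have h1 : φ 0 y = y := (hall (hmem 0 (Metric.mem_closedBall_self (abs_nonneg t)))).2.2
        rw [h1, polyEval_zero_left, flowTaylor, Polynomial.finsetSum_coeff,
          Finset.sum_eq_single 0]
        · simp
        · intro n _ hn
          rw [Polynomial.coeff_monomial, if_neg hn]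
        · simp
      rw [hzero, sub_zero, sub_zero, Real.norm_eq_abs t, mul_assoc, ← pow_succ] at hmv
      simpa [norm_pow] using hmv
  intro N
  refine ⟨flowTaylor h f N, ?_, key N f⟩
  rw [PowerSeries.X_pow_dvd_iff]
  intro m hm
  rw [map_sub, coeff_contactFlow_C, Polynomial.coeff_coe, flowTaylor, Polynomial.finsetSum_coeff,
    Finset.sum_eq_single m]
  · rw [Polynomial.coeff_monomial, if_pos rfl, sub_self]
  · intro n _ hn
    rw [Polynomial.coeff_monomial, if_neg hn]
  · intro h
    exact absurd (Finset.mem_range.2 hm) h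

/-! ### Modified Hamiltonians of words of flows -/

theorem tauContactDeriv_eq (K F : PowerSeries PhasePoly) :
    tauContactDeriv K F = DarbouxRing.contactOp K F := by
  rw [DarbouxRing.contactOp_apply, tauContactDeriv]
  congr 1
  ext1 n
  obtain ⟨U, hU⟩ : ∃ U, U = PowerSeries.C (x 1) * d 2 K + d 0 K := ⟨_, rfl⟩
  obtain ⟨V, hV⟩ : ∃ V, V = PowerSeries.C (x 1) * d 1 K - K := ⟨_, rfl⟩
  have h : DarbouxRing.cderiv K F = d 1 K * d 0 F - U * d 1 F + V * d 2 F := by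
    rw [hU, hV]
    rfl
  rw [PowerSeries.coeff_mk, h]
  simp only [map_add, map_sub, PowerSeries.coeff_mul, DarbouxRing.coeff_d,
    ← Finset.sum_sub_distrib, ← Finset.sum_add_distrib, contactDeriv_eq_cderiv, DarbouxRing.cderiv]
  simp only [hU, hV, map_add, map_sub, PowerSeries.coeff_C_mul, DarbouxRing.coeff_d]

theorem lieSeriesCoeff_eq (K : PowerSeries PhasePoly) (f : PhasePoly) (n : ℕ) :
    lieSeriesCoeff K f n =
      PowerSeries.coeff n (DarbouxRing.contactFlow K (PowerSeries.C f)) := by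
  rw [DarbouxRing.contactFlow, opExp, coeff_funCalc, lieSeriesCoeff]
  refine Finset.sum_congr rfl fun m _ => ?_
  have h : tauContactDeriv K = DarbouxRing.contactOp K := funext (tauContactDeriv_eq K)
  rw [coeff_exp_real, h, Module.End.pow_apply]

/-- The maps of the parts of the Hamiltonian are exact flows. -/
theorem hasDerivAt_vdpMap (ε w : ℝ) (v : VdPPart) {t : ℝ} {y : Phase}
    (ht : 1 + y 1 * (w * t) ≠ 0) :
    HasDerivAt (fun t => vdpMap ε v (w * t) y)
      (fun c => MvPolynomial.eval (vdpMap ε v (w * t) y)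
        (contactField (w • DarbouxRing.partHam (MvPolynomial.C ε) 1 v) c)) t := by
  have hw : HasDerivAt (fun t : ℝ => w * t) w t := by
    simpa using (hasDerivAt_id t).const_mul w
  rw [hasDerivAt_pi]
  cases v with
  | A =>
    have hexp : HasDerivAt (fun t => Real.exp (ε * (w * t) * (1 - y 0 ^ 2)))
        (Real.exp (ε * (w * t) * (1 - y 0 ^ 2)) * (ε * w * (1 - y 0 ^ 2))) t :=
      ((hw.const_mul ε).mul_const _).exp
    intro c
    fin_cases c
    · refine (hasDerivAt_const t (y 0)).congr_deriv ?_
      simp [contactField, DarbouxRing.partHam, DarbouxRing.x_phasePoly, MvPolynomial.pderiv_X,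
        MvPolynomial.smul_eq_C_mul]
    · have h2 : HasDerivAt (fun t => y 1 - 2 * y 0 * y 2 * (w * t) * ε)
          (-(2 * y 0 * y 2 * w * ε)) t :=
        ((hw.const_mul _).mul_const ε).const_sub _
      refine (hexp.mul h2).congr_deriv ?_
      simp [contactField, DarbouxRing.partHam, DarbouxRing.x_phasePoly, MvPolynomial.pderiv_X,
        MvPolynomial.smul_eq_C_mul, vdpMap]
      ring
    · refine (hexp.mul_const (y 2)).congr_deriv ?_
      simp [contactField, DarbouxRing.partHam, DarbouxRing.x_phasePoly, MvPolynomial.pderiv_X,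
        MvPolynomial.smul_eq_C_mul, vdpMap]
      ring
  | B =>
    intro c
    fin_cases c
    · refine (hasDerivAt_const t (y 0)).congr_deriv ?_
      simp [contactField, DarbouxRing.partHam, DarbouxRing.x_phasePoly, MvPolynomial.pderiv_X,
        MvPolynomial.smul_eq_C_mul]
    · refine (hw.const_sub (y 1)).congr_deriv ?_
      simp [contactField, DarbouxRing.partHam, DarbouxRing.x_phasePoly, MvPolynomial.pderiv_X,
        MvPolynomial.smul_eq_C_mul]
    · refine ((hw.mul_const (y 0)).const_sub (y 2)).congr_deriv ?_
      simp [contactField, DarbouxRing.partHam, DarbouxRing.x_phasePoly, MvPolynomial.pderiv_X,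
        MvPolynomial.smul_eq_C_mul, vdpMap]
  | C =>
    intro c
    fin_cases c
    · refine ((hw.mul_const (y 2)).const_add (y 0)).congr_deriv ?_
      simp [contactField, DarbouxRing.partHam, DarbouxRing.x_phasePoly, MvPolynomial.pderiv_X,
        MvPolynomial.smul_eq_C_mul, vdpMap]
    · refine ((hasDerivAt_const t (y 1)).div ((hw.const_mul (y 1)).const_add 1) ht).congr_deriv ?_
      simp [contactField, DarbouxRing.partHam, DarbouxRing.x_phasePoly, MvPolynomial.pderiv_X,
        MvPolynomial.smul_eq_C_mul, vdpMap]
      field_simp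
    · refine (hasDerivAt_const t (y 2)).congr_deriv ?_
      simp [contactField, DarbouxRing.partHam, DarbouxRing.x_phasePoly, MvPolynomial.pderiv_X,
        MvPolynomial.smul_eq_C_mul, vdpMap]
      ring

theorem vdpMap_zero (ε : ℝ) (v : VdPPart) (y : Phase) : vdpMap ε v 0 y = y := by
  ext c
  cases v <;> fin_cases c <;> simp [vdpMap]

theorem continuousAt_vdpMap (ε w : ℝ) (v : VdPPart) (y : Phase) :
    ContinuousAt (fun z : ℝ × Phase => vdpMap ε v (w * z.1) z.2) (0, y) := by
  have hc : ∀ c : Fin 3, Continuous fun z : ℝ × Phase => z.2 c := fun c =>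
    (continuous_apply c).comp continuous_snd
  have h0 := hc 0
  have h1 := hc 1
  have h2 := hc 2
  rw [continuousAt_pi]
  intro c
  cases v with
  | A => fin_cases c <;> simp only [vdpMap] <;> refine Continuous.continuousAt ?_ <;> simp <;> fun_prop
  | B => fin_cases c <;> simp only [vdpMap] <;> refine Continuous.continuousAt ?_ <;> simp <;> fun_prop
  | C =>
    fin_cases c
    · simp only [vdpMap]
      refine Continuous.continuousAt ?_
      simp
      fun_prop
    · refine ContinuousAt.div h1.continuousAt ?_ (by simp)
      refine Continuous.continuousAt ?_
      fun_prop
    · exact h2.continuousAt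

theorem hasExpansion_vdpMap (ε w : ℝ) (v : VdPPart) (x₀ : Phase) (c : Fin 3) :
    HasExpansion (𝓝 x₀) (fun z => vdpMap ε v (w * z.1) z.2 c)
      (DarbouxRing.contactFlow
        (PowerSeries.C (w • DarbouxRing.partHam (MvPolynomial.C ε) 1 v)) (x c)) := by
  have h1 : Tendsto (fun z : ℝ × Phase => vdpMap ε v (w * z.1) z.2) (𝓝 0 ×ˢ 𝓝 x₀) (𝓝 x₀) := by
    have h := (continuousAt_vdpMap ε w v x₀).tendsto
    rw [nhds_prod_eq] at h
    simpa [vdpMap_zero] using h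
  have h2 : ∀ᶠ z : ℝ × Phase in 𝓝 0 ×ˢ 𝓝 x₀, 1 + z.2 1 * (w * z.1) ≠ 0 := by
    rw [← nhds_prod_eq]
    have hc : Continuous fun z : ℝ × Phase => 1 + z.2 1 * (w * z.1) := by fun_prop
    exact hc.continuousAt.eventually_ne (by simp)
  have h3 := hasExpansion_flow (φ := fun t y => vdpMap ε v (w * t) y) h1
    (Filter.Eventually.of_forall fun y => by rw [mul_zero, vdpMap_zero])
    (h2.mono fun z hz => hasDerivAt_vdpMap ε w v hz) (x c)
  simp only [DarbouxRing.x_phasePoly, MvPolynomial.eval_X] at h3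
  exact h3

/-- The composition of the maps of the parts of the Hamiltonian along a word. -/
noncomputable def wordMap (ε : ℝ) : List (VdPPart × ℝ) → ℝ → Phase → Phase
  | [], _ => id
  | p :: W, τ => vdpMap ε p.1 (p.2 * τ) ∘ wordMap ε W τ

/-- Pullback is contravariant: the head letter acts last on points and first on functions, which is
why the recursions of `wordMap` and `wordOp` match. -/
theorem hasExpansion_wordMap (ε : ℝ) (W : List (VdPPart × ℝ)) (x₀ : Phase) (c : Fin 3) :
    HasExpansion (𝓝 x₀) (fun z => wordMap ε W z.1 z.2 c)
      (DarbouxRing.wordOp (MvPolynomial.C ε) 1 W (x c)) := by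
  induction W generalizing c with
  | nil =>
    have h := HasExpansion.polynomial (l := 𝓝 x₀) (Polynomial.C (MvPolynomial.X c))
    rw [Polynomial.coe_C] at h
    have e : polyEval (Polynomial.C (MvPolynomial.X c)) = fun z => wordMap ε [] z.1 z.2 c := by
      funext z
      rw [polyEval_C, MvPolynomial.eval_X, wordMap, id]
    rw [e] at h
    exact h
  | cons p W ih =>
    obtain ⟨Ψ, hΨ⟩ :=
      DarbouxRing.exists_isContactPair_wordOp (MvPolynomial.C ε : PhasePoly) 1 W
    exact HasExpansion.comp le_rfl hΨ (S := fun z => wordMap ε W z.1 z.2) ih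
      (hasExpansion_vdpMap ε p.2 p.1 x₀ c)

/-- Asymptotic coefficients at a point are unique, and a polynomial is determined by its values at
all points. The analytic condition is therefore an identity of formal series. -/
theorem isModifiedHamiltonian_wordMap_iff (ε : ℝ) (W : List (VdPPart × ℝ))
    (K : PowerSeries PhasePoly) :
    IsModifiedHamiltonian (wordMap ε W) K ↔
      ∀ c, DarbouxRing.contactFlow K (x c) =
        DarbouxRing.wordOp (MvPolynomial.C ε) 1 W (x c) := by
  have hexp := fun (y : Phase) (c : Fin 3) (N : ℕ) =>
    (hasExpansion_wordMap ε W y c).isBigO_at (pure_le_nhds y) N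
  constructor
  · intro h c
    ext1 n
    refine MvPolynomial.funext fun y => ?_
    have h1 := h y c n
    simp only [lieSeriesCoeff_eq] at h1
    exact coeff_eq_of_isBigO h1 (hexp y c (n + 1)) n (Nat.lt_succ_self n)
  · intro h y c N
    have h1 := hexp y c (N + 1)
    simp only [← h c] at h1
    simp only [lieSeriesCoeff_eq]
    exact h1

/-! ### Contact splitting integrators as palindromic words -/

/-- Rescaling of the weights of a word. -/
def scaleWord (r : ℝ) (W : List (VdPPart × ℝ)) : List (VdPPart × ℝ) :=
  W.map fun p => (p.1, r * p.2)

theorem wordMap_scaleWord (ε r : ℝ) (W : List (VdPPart × ℝ)) (τ : ℝ) :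
    wordMap ε (scaleWord r W) τ = wordMap ε W (r * τ) := by
  induction W with
  | nil => rfl
  | cons p W ih =>
    have e : r * p.2 * τ = p.2 * (r * τ) := by ring
    rw [scaleWord] at ih
    rw [scaleWord, List.map_cons, wordMap, wordMap, ih, e]

theorem wordMap_append (ε : ℝ) (W W' : List (VdPPart × ℝ)) (τ : ℝ) :
    wordMap ε (W ++ W') τ = wordMap ε W τ ∘ wordMap ε W' τ := by
  induction W with
  | nil => rfl
  | cons p W ih => rw [List.cons_append, wordMap, wordMap, ih, Function.comp_assoc]

/-- The word of a basic splitting. -/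
noncomputable def basicWord (σ : Fin 3 ≃ VdPPart) : List (VdPPart × ℝ) :=
  [(σ 0, 2⁻¹), (σ 1, 2⁻¹), (σ 2, 1), (σ 1, 2⁻¹), (σ 0, 2⁻¹)]

theorem basicSplitting_eq_wordMap (σ : Fin 3 ≃ VdPPart) (ε τ : ℝ) :
    basicSplitting σ ε τ = wordMap ε (basicWord σ) τ := by
  simp only [basicSplitting, basicWord, wordMap, div_eq_inv_mul, one_mul]
  rfl

theorem exists_word_symmetricComposition (w : ℕ → ℝ) (m : ℕ) {W : List (VdPPart × ℝ)}
    (hW : W.reverse = W) :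
    ∃ V : List (VdPPart × ℝ), V.reverse = V ∧
      ∀ ε τ, symmetricComposition (wordMap ε W) w m τ = wordMap ε V τ := by
  have hs : ∀ r, (scaleWord r W).reverse = scaleWord r W := fun r => by
    rw [scaleWord, ← List.map_reverse, hW]
  induction m with
  | zero =>
    refine ⟨scaleWord (w 0) W, hs _, fun ε τ => ?_⟩
    rw [symmetricComposition, wordMap_scaleWord]
  | succ m ih =>
    obtain ⟨V, hV, hVS⟩ := ih
    refine ⟨scaleWord (w (m + 1)) W ++ (V ++ scaleWord (w (m + 1)) W), ?_, fun ε τ => ?_⟩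
    · rw [List.reverse_append, List.reverse_append, hV, hs, List.append_assoc]
    · rw [symmetricComposition, hVS, wordMap_append, wordMap_append, wordMap_scaleWord]

theorem IsContactSplittingIntegrator.exists_word {S : ℝ → ℝ → Phase → Phase}
    (hS : IsContactSplittingIntegrator S) :
    ∃ W : List (VdPPart × ℝ), W.reverse = W ∧ ∀ ε, S ε = wordMap ε W := by
  induction hS with
  | basic σ =>
    exact ⟨basicWord σ, by simp [basicWord], fun ε => funext (basicSplitting_eq_wordMap σ ε)⟩
  | comp hS w m ih =>
    obtain ⟨W, hW, hSW⟩ := ih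
    obtain ⟨V, hV, hVS⟩ := exists_word_symmetricComposition w m hW
    refine ⟨V, hV, fun ε => funext fun τ => ?_⟩
    simp only [hSW, hVS]

/-! ### Order conditions -/

theorem exists_integralCurve (h : PhasePoly) (y : Phase) :
    ∃ γ : ℝ → Phase, γ 0 = y ∧ ∀ᶠ t in 𝓝 (0 : ℝ),
      HasDerivAt γ (fun c => MvPolynomial.eval (γ t) (contactField h c)) t := by
  have hf : ContDiffAt ℝ 1 (fun y : Phase => fun c => MvPolynomial.eval y (contactField h c)) y :=
    contDiffAt_pi.2 fun c => ((AnalyticOnNhd.eval_mvPolynomial (contactField h c)) y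
      (Set.mem_univ y)).contDiffAt
  obtain ⟨γ, h0, e, he, hγ⟩ :=
    hf.exists_forall_mem_closedBall_exists_eq_forall_mem_Ioo_hasDerivAt₀ 0
  refine ⟨γ, h0, ?_⟩
  filter_upwards [Ioo_mem_nhds (show (0 : ℝ) - e < 0 by linarith)
    (show (0 : ℝ) < 0 + e by linarith)] with t ht
  exact hγ t ht

/-- The method and an exact solution through each point have equal Taylor coefficients up to τ^r.
One order is lost in passing to Hamiltonians because of the factor τ in exp(τX_K). -/
theorem X_pow_dvd_of_hasOrder {ε : ℝ} {W : List (VdPPart × ℝ)} {h : PhasePoly} {r : ℕ}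
    (hord : HasOrder h (wordMap ε W) r) {K : PowerSeries PhasePoly}
    (hK : IsModifiedHamiltonian (wordMap ε W) K) :
    PowerSeries.X ^ r ∣ K - PowerSeries.C h := by
  refine DarbouxRing.X_pow_dvd_sub_of_contactFlow fun c => ?_
  rw [PowerSeries.X_pow_dvd_iff]
  intro m hm
  rw [map_sub, sub_eq_zero]
  refine MvPolynomial.funext fun y => ?_
  obtain ⟨γ, hγ0, hγ⟩ := exists_integralCurve h y
  have h1 := isBigO_pi.1 (hord γ hγ) c
  have h2 := hK (γ 0) c r
  simp only [lieSeriesCoeff_eq] at h2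
  -- Only one solution curve is at hand, so the base point is held fixed by the principal filter.
  have h3 : HasExpansion (pure y) (fun z => MvPolynomial.eval (γ z.1) (x c))
      (DarbouxRing.contactFlow (PowerSeries.C h) (PowerSeries.C (x c))) := by
    refine hasExpansion_flow (φ := fun t _ => γ t) (x₀ := y) ?_ ?_ ?_ (x c)
    · have := hγ.self_of_nhds.continuousAt.tendsto
      rw [hγ0] at this
      exact this.comp tendsto_fst
    · exact hγ0
    · exact (hγ.prod_inl (pure y)).mono fun z hz => hz
  have h4 := h3.isBigO_at le_rfl (r + 1)
  rw [hγ0] at h1 h2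
  refine coeff_eq_of_isBigO (G := fun τ => γ τ c)
    (a := fun n => MvPolynomial.eval y
      (PowerSeries.coeff n (DarbouxRing.contactFlow K (x c))))
    (b := fun n => MvPolynomial.eval y
      (PowerSeries.coeff n (DarbouxRing.contactFlow (PowerSeries.C h) (x c)))) ((h2.sub h1).congr_left fun τ => ?_)
    (h4.congr_left fun τ => ?_) m hm
  · simp only [Pi.sub_apply]
    rw [sub_right_comm, sub_sub_cancel]
    rfl
  · simp [DarbouxRing.x_phasePoly, DarbouxRing.x_powerSeries]

/-! ### Dependence on the parameter -/

section Parameter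

variable {W : List (VdPPart × ℝ)} {M : PowerSeries (Polynomial PhasePoly)}

/-- Specializing ε commutes with the derivations and flows, so one generic Hamiltonian specializes
to a Hamiltonian for each ε; injectivity of the flow makes it the only one. -/
theorem isModifiedHamiltonian_wordMap_iff_eq_atEps
    (hM : ∀ c, DarbouxRing.contactFlow M (x c) = DarbouxRing.wordOp Polynomial.X 1 W (x c))
    (ε : ℝ) (K : PowerSeries PhasePoly) :
    IsModifiedHamiltonian (wordMap ε W) K ↔ K = atEps ε M := by
  have h1 : ∀ c, DarbouxRing.contactFlow (atEps ε M) (x c) =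
      DarbouxRing.wordOp (MvPolynomial.C ε) 1 W (x c) := fun c => by
    have hε := DarbouxRing.isDarbouxHom_evalParam ε
    have h2 := hε.map_contactFlow M (x c)
    rw [hM, hε.map_wordOp, hε.map_x_powerSeries, map_one, DarbouxRing.evalParam_apply,
      Polynomial.eval_X] at h2
    exact h2.symm
  rw [isModifiedHamiltonian_wordMap_iff]
  constructor
  · intro h
    exact DarbouxRing.contactFlow_injective fun c => by rw [h, h1]
  · rintro rfl
    exact h1

/-- Comparison of the two normalizations of the parameters. -/
theorem eval_coeff_eq {κ : PowerSeries (Polynomial PhasePoly)}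
    (hM : ∀ c, DarbouxRing.contactFlow M (x c) = DarbouxRing.wordOp Polynomial.X 1 W (x c))
    (hκ : ∀ c, DarbouxRing.contactFlow κ (x c) = DarbouxRing.wordOp 1 Polynomial.X W (x c))
    (k : ℕ) {e : ℝ} (he : 0 < e) :
    (PowerSeries.coeff k M).eval (MvPolynomial.C e) =
      MvPolynomial.C e ^ (k + 1) * (PowerSeries.coeff k κ).eval (MvPolynomial.C e⁻¹) := by
  have h1 : ∀ c, DarbouxRing.contactFlow (atEps e⁻¹ κ) (x c) =
      DarbouxRing.wordOp 1 (MvPolynomial.C e⁻¹) W (x c) := fun c => by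
    have hε := DarbouxRing.isDarbouxHom_evalParam e⁻¹
    have h2 := hε.map_contactFlow κ (x c)
    rw [hκ, hε.map_wordOp, hε.map_x_powerSeries, map_one, DarbouxRing.evalParam_apply,
      Polynomial.eval_X] at h2
    exact h2.symm
  have h2 := fun c => DarbouxRing.contactFlow_rescale_eq_wordOp h1 e c
  have e1 : e • (1 : PhasePoly) = MvPolynomial.C e := by simp [MvPolynomial.smul_eq_C_mul]
  have e2 : e • (MvPolynomial.C e⁻¹ : PhasePoly) = 1 := by
    rw [MvPolynomial.smul_eq_C_mul, ← map_mul, mul_inv_cancel₀ he.ne', map_one]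
  rw [e1, e2, ← isModifiedHamiltonian_wordMap_iff,
    isModifiedHamiltonian_wordMap_iff_eq_atEps hM] at h2
  have h3 := congrArg (PowerSeries.coeff k) h2
  rw [coeff_real_smul, PowerSeries.coeff_rescale, atEps, atEps, PowerSeries.coeff_map,
    PowerSeries.coeff_map, Polynomial.coe_evalRingHom, Polynomial.coe_evalRingHom] at h3
  rw [← h3, MvPolynomial.smul_eq_C_mul, pow_succ', mul_assoc]
  rfl

/-- Homogeneity bounds the degree by k+1, and ε^(k+1) corresponds to β = 0, where nothing survives
at τ^k for k ≠ 0. At k = 0 the part A itself is linear in ε, hence the side condition. -/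
theorem coeff_coeff_eq_zero
    (hM : ∀ c, DarbouxRing.contactFlow M (x c) = DarbouxRing.wordOp Polynomial.X 1 W (x c))
    {k j : ℕ} (hj : k < j) (hk : k ≠ 0 ∨ 2 ≤ j) : (PowerSeries.coeff k M).coeff j = 0 := by
  obtain ⟨κ, hκ⟩ := DarbouxRing.exists_contactFlow_eq_wordOp
    (1 : Polynomial PhasePoly) Polynomial.X W
  have h := coeff_of_eval_inv fun e he => eval_coeff_eq hM hκ k (e := e) he
  rcases Nat.lt_or_ge (k + 1) j with h1 | h1
  · exact h.1 j h1
  · obtain rfl : j = k + 1 := by omega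
    have h2 := h.2 0 (Nat.zero_le _)
    rw [Nat.sub_zero] at h2
    rw [h2]
    exact DarbouxRing.coeff_zero_coeff hκ (by omega)

theorem natDegree_coeff_le
    (hM : ∀ c, DarbouxRing.contactFlow M (x c) = DarbouxRing.wordOp Polynomial.X 1 W (x c))
    {k : ℕ} (hk : k ≠ 0) : (PowerSeries.coeff k M).natDegree ≤ k :=
  Polynomial.natDegree_le_iff_coeff_eq_zero.2 fun _ hj => coeff_coeff_eq_zero hM hj (Or.inl hk)

theorem coeff_truncEps (M : PowerSeries (Polynomial PhasePoly)) (r j : ℕ) :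
    (truncEps M r).coeff j = ∑ k ∈ Finset.range (r + 1),
      Polynomial.X ^ k * Polynomial.C ((PowerSeries.coeff k M).coeff j) := by
  simp only [truncEps, Polynomial.finsetSum_coeff, Polynomial.coeff_C_mul, Polynomial.coeff_map]

theorem natDegree_truncEps_le
    (hM : ∀ c, DarbouxRing.contactFlow M (x c) = DarbouxRing.wordOp Polynomial.X 1 W (x c))
    {r : ℕ} (hr : r ≠ 0) : (truncEps M r).natDegree ≤ r := by
  refine Polynomial.natDegree_le_iff_coeff_eq_zero.2 fun j hj => ?_
  rw [coeff_truncEps]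
  refine Finset.sum_eq_zero fun k hk => ?_
  rw [Finset.mem_range] at hk
  -- For k = 0 the alternative 2 ≤ j holds because j > r ≥ 1.
  rw [coeff_coeff_eq_zero hM (by omega) (by omega), map_zero, mul_zero]

theorem natDegree_truncEps_ge {r : ℕ} (h : (PowerSeries.coeff r M).coeff r ≠ 0) :
    r ≤ (truncEps M r).natDegree := by
  refine Polynomial.le_natDegree_of_ne_zero fun h0 => h ?_
  have h1 := congrArg (fun p => Polynomial.coeff p r) h0
  simp only [coeff_truncEps, Polynomial.finsetSum_coeff, Polynomial.coeff_zero] at h1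
  rw [Finset.sum_eq_single r] at h1
  · simpa using h1
  · intro k _ hk
    rw [mul_comm, Polynomial.coeff_C_mul, Polynomial.coeff_X_pow, if_neg (Ne.symm hk), mul_zero]
  · intro h2
    exact absurd (Finset.mem_range.2 (Nat.lt_succ_self r)) h2

/-- The top coefficient in the parameter of a word of total weight `1`. -/
theorem coeff_coeff_self_ne_zero
    (hM : ∀ c, DarbouxRing.contactFlow M (x c) = DarbouxRing.wordOp Polynomial.X 1 W (x c))
    (hW : DarbouxRing.weightA W = 1) {k : ℕ}
    (hk : PowerSeries.coeff k (bernoulliPowerSeries ℝ * DarbouxRing.linSeries W) ≠ 0) :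
    (PowerSeries.coeff k M).coeff k ≠ 0 := by
  obtain ⟨κ, hκ⟩ := DarbouxRing.exists_contactFlow_eq_wordOp
    (1 : Polynomial PhasePoly) Polynomial.X W
  -- Reversal in degree k+1 matches ε^k with the first power of β.
  have h := (coeff_of_eval_inv fun e he => eval_coeff_eq hM hκ k (e := e) he).2 1 (by omega)
  rw [Nat.add_sub_cancel] at h
  rw [h]
  intro h0
  have h1 := DarbouxRing.d_coeff_one_coeff hW hκ k
  rw [h0, map_zero] at h1
  rcases smul_eq_zero.1 h1.symm with h2 | h2
  · exact hk h2
  -- At q = p = 0, s = 1 the polynomial (1-q²)^k s takes the value 1.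
  · have h3 := congrArg (MvPolynomial.eval (fun c : Fin 3 => if c = 2 then (1 : ℝ) else 0)) h2
    simp [DarbouxRing.x_phasePoly] at h3

end Parameter

/-! ### The six basic splittings and the final assembly. -/

theorem weightA_basicWord (σ : Fin 3 ≃ VdPPart) : DarbouxRing.weightA (basicWord σ) = 1 := by
  have h01 : σ 0 ≠ σ 1 := fun h => by simpa using σ.injective h
  have h02 : σ 0 ≠ σ 2 := fun h => by simpa using σ.injective h
  have h12 : σ 1 ≠ σ 2 := fun h => by simpa using σ.injective h
  rw [basicWord]
  generalize σ 0 = a at *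
  generalize σ 1 = b at *
  generalize σ 2 = c at *
  cases a <;> cases b <;> cases c <;>
    first
    | exact absurd rfl h01
    | exact absurd rfl h02
    | exact absurd rfl h12
    | (simp only [DarbouxRing.weightA]; norm_num)

/-- Only the relative position of A and C matters. If A lies outside C, each letter C has weight 1/2
of A to its right. If A lies inside, the two half-steps of C see weights 1 and 0. -/
theorem linSeries_basicWord (σ : Fin 3 ≃ VdPPart) :
    DarbouxRing.linSeries (basicWord σ) = PowerSeries.rescale (2⁻¹ : ℝ) (PowerSeries.exp ℝ) ∨
      DarbouxRing.linSeries (basicWord σ) = (2⁻¹ : ℝ) • (PowerSeries.exp ℝ + 1) := by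
  have h01 : σ 0 ≠ σ 1 := fun h => by simpa using σ.injective h
  have h02 : σ 0 ≠ σ 2 := fun h => by simpa using σ.injective h
  have h12 : σ 1 ≠ σ 2 := fun h => by simpa using σ.injective h
  have e0 : PowerSeries.rescale (0 : ℝ) (PowerSeries.exp ℝ) = 1 := by
    rw [PowerSeries.rescale_zero_apply]; simp
  have e1 : PowerSeries.rescale (1 : ℝ) (PowerSeries.exp ℝ) = PowerSeries.exp ℝ := by
    rw [PowerSeries.rescale_one]; rfl
  have e2 : ∀ F : PowerSeries ℝ, (2⁻¹ : ℝ) • F + (2⁻¹ : ℝ) • F = F := fun F => by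
    rw [← add_smul]; norm_num
  have e3 : (2⁻¹ : ℝ) + 2⁻¹ = 1 := by norm_num
  rw [basicWord]
  generalize σ 0 = a at *
  generalize σ 1 = b at *
  generalize σ 2 = c at *
  cases a <;> cases b <;> cases c <;>
    first
    | exact absurd rfl h01
    | exact absurd rfl h02
    | exact absurd rfl h12
    | (left
       simp only [DarbouxRing.weightA, DarbouxRing.linSeries, zero_add, add_zero, one_smul, e2]
       done)
    | (right
       simp only [DarbouxRing.weightA, DarbouxRing.linSeries, zero_add, add_zero, e0, e1, e3,
         smul_add]
       rw [add_comm])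

theorem mainTheorem4 :
    (∀ n : ℕ, 1 ≤ n → ∀ S : ℝ → ℝ → Phase → Phase, IsContactSplittingIntegrator S →
      (∀ ε : ℝ, 0 < ε → HasOrder (vdpHamiltonian ε) (S ε) (2 * n)) →
      ∃ M : PowerSeries (Polynomial PhasePoly),
        (∀ (ε : ℝ) (K : PowerSeries PhasePoly),
          IsModifiedHamiltonian (S ε) K ↔ K = atEps ε M) ∧
        (∀ ε : ℝ, PowerSeries.coeff 0 (atEps ε M) = vdpHamiltonian ε) ∧
        (∀ k : ℕ, Odd k → PowerSeries.coeff k M = 0) ∧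
        (∀ k : ℕ, 0 < k → k < 2 * n → PowerSeries.coeff k M = 0) ∧
        (∀ i : ℕ, 1 ≤ i →
          (PowerSeries.coeff (2 * i) M).natDegree ≤ 2 * i ∧
          (truncEps M (2 * i)).natDegree ≤ 2 * i)) ∧
    (∀ σ : Fin 3 ≃ VdPPart, ∃ M : PowerSeries (Polynomial PhasePoly),
        (∀ (ε : ℝ) (K : PowerSeries PhasePoly),
          IsModifiedHamiltonian (basicSplitting σ ε) K ↔ K = atEps ε M) ∧
        (∀ i : ℕ, 1 ≤ i →
          (PowerSeries.coeff (2 * i) M).natDegree = 2 * i ∧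
          (truncEps M (2 * i)).natDegree = 2 * i)) := by
  constructor
  · intro n hn S hS hord
    obtain ⟨W, hW, hSW⟩ := hS.exists_word
    obtain ⟨M, hM⟩ := DarbouxRing.exists_contactFlow_eq_wordOp
      (Polynomial.X : Polynomial PhasePoly) 1 W
    have hmod : ∀ (ε : ℝ) (K : PowerSeries PhasePoly),
        IsModifiedHamiltonian (S ε) K ↔ K = atEps ε M := fun ε K => by
      rw [hSW, isModifiedHamiltonian_wordMap_iff_eq_atEps hM]
    have hcoeff : ∀ (ε : ℝ) (k : ℕ), PowerSeries.coeff k (atEps ε M) =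
        (PowerSeries.coeff k M).eval (MvPolynomial.C ε) := fun ε k => by
      rw [atEps, PowerSeries.coeff_map, Polynomial.coe_evalRingHom]
    have hdvd : ∀ ε : ℝ, 0 < ε →
        PowerSeries.X ^ (2 * n) ∣ atEps ε M - PowerSeries.C (vdpHamiltonian ε) := fun ε hε => by
      have h1 := hord ε hε
      have h2 := (hmod ε _).2 rfl
      rw [hSW] at h1 h2
      exact X_pow_dvd_of_hasOrder h1 h2
    refine ⟨M, hmod, ?_, ?_, ?_, fun i hi => ⟨natDegree_coeff_le hM (by omega),
      natDegree_truncEps_le hM (by omega)⟩⟩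
    · set p : Polynomial PhasePoly :=
        Polynomial.C (MvPolynomial.X 1 * MvPolynomial.X 2) -
          Polynomial.X * Polynomial.C ((1 - MvPolynomial.X 0 ^ 2) * MvPolynomial.X 2) +
          Polynomial.C (MvPolynomial.X 0) with hp
      have hpe : ∀ ε : ℝ, p.eval (MvPolynomial.C ε) = vdpHamiltonian ε := fun ε => by
        rw [hp, vdpHamiltonian, Polynomial.eval_add, Polynomial.eval_sub, Polynomial.eval_mul,
          Polynomial.eval_C, Polynomial.eval_C, Polynomial.eval_C, Polynomial.eval_X, mul_assoc]
      -- Order gives this for ε > 0 only; as an identity of polynomials in ε it then holds for every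
      -- real ε.
      have hMp : PowerSeries.coeff 0 M = p := eq_of_eval_C_eq fun ε hε => by
        have h1 := PowerSeries.X_pow_dvd_iff.1 (hdvd ε hε) 0 (by omega)
        rw [map_sub, sub_eq_zero, hcoeff] at h1
        rw [h1, hpe]
        simp
      intro ε
      rw [hcoeff, hMp, hpe]
    · intro k hk
      refine eq_of_eval_C_eq fun ε _ => ?_
      rw [← hcoeff, Polynomial.eval_zero]
      have h1 := (hmod ε _).2 rfl
      rw [hSW, isModifiedHamiltonian_wordMap_iff] at h1
      exact DarbouxRing.coeff_eq_zero_of_odd hW h1 hk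
    · intro k hk hkn
      refine eq_of_eval_C_eq fun ε hε => ?_
      have h1 := PowerSeries.X_pow_dvd_iff.1 (hdvd ε hε) k hkn
      rw [map_sub, sub_eq_zero, hcoeff, PowerSeries.coeff_C, if_neg hk.ne'] at h1
      rw [h1, Polynomial.eval_zero]
  · intro σ
    obtain ⟨M, hM⟩ := DarbouxRing.exists_contactFlow_eq_wordOp
      (Polynomial.X : Polynomial PhasePoly) 1 (basicWord σ)
    refine ⟨M, fun ε K => ?_, fun i hi => ?_⟩
    · have h : basicSplitting σ ε = wordMap ε (basicWord σ) :=
        funext (basicSplitting_eq_wordMap σ ε)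
      rw [h, isModifiedHamiltonian_wordMap_iff_eq_atEps hM]
    · have hi0 : i ≠ 0 := by omega
      have h : (PowerSeries.coeff (2 * i) M).coeff (2 * i) ≠ 0 := by
        refine coeff_coeff_self_ne_zero hM (weightA_basicWord σ) ?_
        rcases linSeries_basicWord σ with h1 | h1
        · rw [h1]
          exact coeff_bernoulliPowerSeries_mul_exp_half_ne_zero hi0
        · rw [h1]
          exact coeff_bernoulliPowerSeries_mul_cosh_ne_zero hi0
      exact ⟨le_antisymm (natDegree_coeff_le hM (by omega))
          (Polynomial.le_natDegree_of_ne_zero h),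
        le_antisymm (natDegree_truncEps_le hM (by omega)) (natDegree_truncEps_ge h)⟩
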